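/- Let $\Omega=(\Omega_n)_{n\ge 0}\subset[0,\infty)$ be a sequence with $\Omega_0\neq 0$, and put $W_n=\sum_{k=0}^n\Omega_k$ for $n=0,1,2,\dots$. For a complex sequence $f=(f(n))_{n\ge0}$ let $f^*(n)=\inf\{s>0 : \#\{k : |f(k)|>s\}\le n\}\in[0,\infty]$ be its nonincreasing rearrangement. For $0<p<\infty$ put $\|f\|_{d(\Omega,p)}=\bigl(\sum_{n=0}^\infty f^*(n)^p\,\Omega_n\bigr)^{1/p}\in[0,\infty]$ (with $0\cdot\infty=0$), and let $d(\Omega,p)$ be the set of all complex sequences $f$ with $\|f\|_{d(\Omega,p)}<\infty$. Call $d(\Omega,p)$ normable if it is a vector space and carries a norm that is equivalent to $\|\cdot\|_{d(\Omega,p)}$. Then: (i) If $0<p<1$, then $d(\Omega,p)$ is normable if and only if $\Omega\in\ell^1$; and if $\Omega\in\ell^1$, then $d(\Omega,p)=\ell^\infty$. (ii) $d(\Omega,1)$ is normable if and only if there is a constant $C$ such that $$\frac{W_n}{n+1}\le C\,\frac{W_m}{m+1}\qquad\text{for all } 0<m<n.$$ (iii) If $1<p<\infty$, then $d(\Omega,p)$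 is normable if and only if there is a constant $C$ such that $$\sum_{k=0}^n\frac1{W_k^{1/p}}\le C\,\frac{n+1}{W_n^{1/p}}\qquad\text{for all } n=0,1,2,\dots.$$ -/

import Mathlib

open scoped NNReal ENNReal

noncomputable section

/-- The distribution function `λ_f(s)` of a complex sequence with respect to counting measure:
the (possibly infinite) number of indices `k` with `|f k| > s`. -/
def seqDistribution (f : ℕ → ℂ) (s : ℝ≥0) : ℕ∞ :=
  {k : ℕ | s < ‖f k‖₊}.encard

/-- The nonincreasing rearrangement `f* n = inf {s > 0 : λ_f(s) ≤ n}`, with values in `[0, ∞]`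
(the infimum of the empty set is `∞`, so an unbounded sequence has `f* = ∞`). -/
def seqRearrangement (f : ℕ → ℂ) (n : ℕ) : ℝ≥0∞ :=
  ⨅ (s : ℝ≥0) (_ : 0 < s) (_ : seqDistribution f s ≤ (n : ℕ∞)), (s : ℝ≥0∞)

/-- The functional `‖f‖_{d(Ω,p)} = (∑ n, (f* n) ^ p * Ω n) ^ (1/p)`, with values in `[0, ∞]`. -/
def lorentzSeqNorm (Ω : ℕ → ℝ≥0) (p : ℝ) (f : ℕ → ℂ) : ℝ≥0∞ :=
  (∑' n, seqRearrangement f n ^ p * (Ω n : ℝ≥0∞)) ^ (1 / p)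

/-- The Lorentz sequence space `d(Ω,p)`, a set of complex sequences (in general not a vector
space). -/
def lorentzSeq (Ω : ℕ → ℝ≥0) (p : ℝ) : Set (ℕ → ℂ) :=
  {f | lorentzSeqNorm Ω p f < ∞}

/-- `d(Ω,p)` is normable: it is a vector space, and it carries a norm which is equivalent to the
functional `‖·‖_{d(Ω,p)}`. -/
def LorentzSeqNormable (Ω : ℕ → ℝ≥0) (p : ℝ) : Prop :=
  ∃ V : Submodule ℂ (ℕ → ℂ), (V : Set (ℕ → ℂ)) = lorentzSeq Ω p ∧
    ∃ N : Seminorm ℂ V, (∀ f : V, N f = 0 → f = 0) ∧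
      ∃ C : ℝ≥0, ∀ f : V,
        ENNReal.ofReal (N f) ≤ C * lorentzSeqNorm Ω p f ∧
        lorentzSeqNorm Ω p f ≤ C * ENNReal.ofReal (N f)

/-- The partial sums `W n = Ω 0 + ⋯ + Ω n`. -/
def weightSum (Ω : ℕ → ℝ≥0) (n : ℕ) : ℝ≥0 :=
  ∑ k ∈ Finset.range (n + 1), Ω k

end

/-!
Write `W n = Ω 0 + ⋯ + Ω n` and `φ L = W (L - 1) ^ (1 / p)`, the value of the functional at the
indicator of `L` indices.

*Necessity.* A norm equivalent to the functional makes it subadditive up to a constant, uniformly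
in the number of summands. For `p < 1` and `Ω` not summable, this fails for sums of normalised
indicators of initial segments along which `W` at least doubles
(`summable_of_lorentzSeqNormable`). For `p ≥ 1` the functional is invariant under permutations,
so the mean of a nonnegative nonincreasing sequence over `[0, n)`, as a multiple of the indicator
of `[0, n)`, is controlled by the sequence itself (`LorentzSeqNormable.exists_averaging`).
Applied to indicators this gives `m φ n ≤ K n φ m` for `m ≤ n`, which is the condition for
`p = 1`. For `p > 1` a truncation of `k ↦ L / k` gains a power of a logarithm: its mean exceeds
its functional by that factor. Hence some dilation satisfies `φ (m L) ≤ (m / 2) φ L` for all `L`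
(`LorentzSeqNormable.exists_dilation`), and such an estimate is equivalent to the condition on
`∑ 1 / φ` (`sum_inv_le_of_dilation`, `exists_dilation_of_sum_inv_le`).

*Sufficiency.* For summable `Ω` the functional is equivalent to the supremum norm. For `p = 1`
the sequence `W` is equivalent to a concave one, so `Ω` may be replaced by a nonincreasing weight
`w`, for which `∑ f* n w n` is equivalent to a supremum of sums `∑ |f (σ n)| w n`
(`exists_antitone_weight`, `injectionNorm`). For `p > 1` the dilation estimate with `m / 4` yields
Hardy's inequality for the means of `f*` (`hardy_inequality`), and those means dominate the
subadditive quantities `topSum f (n + 1) / (n + 1) ≥ f* n`; their weighted `ℓ^p` norm is the norm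
sought.
-/

/-! ### The nonincreasing rearrangement -/

theorem seqRearrangement_antitone (f : ℕ → ℂ) : Antitone (seqRearrangement f) := by
  intro m n hmn
  refine le_iInf fun s => le_iInf fun hs => le_iInf fun h => ?_
  exact iInf_le_of_le s (iInf_le_of_le hs (iInf_le_of_le
    (h.trans (by exact_mod_cast hmn)) le_rfl))

theorem seqRearrangement_comp_le (f : ℕ → ℂ) {σ : ℕ → ℕ} (hσ : Function.Injective σ) (n : ℕ) :
    seqRearrangement (f ∘ σ) n ≤ seqRearrangement f n := by
  refine le_iInf fun s => le_iInf fun hs => le_iInf fun h => ?_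
  refine iInf_le_of_le s (iInf_le_of_le hs (iInf_le_of_le (le_trans ?_ h) le_rfl))
  unfold seqDistribution
  rw [← hσ.encard_image]
  apply Set.encard_le_encard
  rintro _ ⟨k, hk, rfl⟩
  exact hk

/-- If more than `n` indices satisfy `a ≤ |f k|`, then `a ≤ f* n`. -/
theorem le_seqRearrangement (f : ℕ → ℂ) {n : ℕ} {A : Finset ℕ} (hA : n < A.card) {a : ℝ≥0∞}
    (h : ∀ k ∈ A, a ≤ ‖f k‖₊) : a ≤ seqRearrangement f n := by
  refine le_iInf fun s => le_iInf fun hs => le_iInf fun hd => ?_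
  by_contra! hlt
  have hsub : (A : Set ℕ) ⊆ {k : ℕ | s < ‖f k‖₊} := fun k hk => by
    have := hlt.trans_le (h k hk)
    exact_mod_cast this
  have h1 := (Set.encard_le_encard hsub).trans hd
  rw [Set.encard_coe_eq_coe_finsetCard] at h1
  have : A.card ≤ n := by exact_mod_cast h1
  omega

/-- Below the level `f* n` there are at least `n + 1` indices. -/
theorem exists_finset_of_lt_seqRearrangement (f : ℕ → ℂ) {n : ℕ} {t : ℝ≥0∞}
    (h : t < seqRearrangement f n) :
    ∃ A : Finset ℕ, A.card = n + 1 ∧ ∀ k ∈ A, t ≤ ‖f k‖₊ := by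
  obtain ⟨u, htu, hu⟩ := exists_between h
  lift u to ℝ≥0 using hu.ne_top
  have hu0 : 0 < u := by
    have : (0 : ℝ≥0∞) < u := zero_le.trans_lt htu
    exact_mod_cast this
  have hd : ¬ seqDistribution f u ≤ (n : ℕ∞) := fun hd =>
    absurd (iInf_le_of_le u (iInf_le_of_le hu0 (iInf_le_of_le hd le_rfl))) (not_le.2 hu)
  have hd' : ((n + 1 : ℕ) : ℕ∞) ≤ {k : ℕ | u < ‖f k‖₊}.encard := by
    push_cast
    exact Order.add_one_le_of_lt (not_le.1 hd)
  obtain ⟨T, hT, hc⟩ := Set.exists_subset_encard_eq hd'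
  have hfin : T.Finite := Set.finite_of_encard_eq_coe hc
  refine ⟨hfin.toFinset, ?_, fun k hk => ?_⟩
  · rw [hfin.encard_eq_coe_toFinset_card] at hc
    exact_mod_cast hc
  · have := hT ((Set.Finite.mem_toFinset hfin).1 hk)
    refine htu.le.trans ?_
    exact_mod_cast (le_of_lt this)

theorem seqRearrangement_of_antitone {f : ℕ → ℂ} (hf : Antitone fun k => ‖f k‖₊) (n : ℕ) :
    seqRearrangement f n = ‖f n‖₊ := by
  refine le_antisymm ?_ ?_
  · by_contra! h
    obtain ⟨A, hA, hAt⟩ := exists_finset_of_lt_seqRearrangement f h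
    obtain ⟨u, hu, hu'⟩ := exists_between h
    obtain ⟨A, hA, hAt⟩ := exists_finset_of_lt_seqRearrangement f hu'
    have : A ⊆ Finset.range n := fun k hk => by
      rw [Finset.mem_range]
      by_contra! hnk
      have h1 := hu.trans_le (hAt k hk)
      have h2 : ‖f k‖₊ ≤ ‖f n‖₊ := hf hnk
      exact absurd h1 (not_lt.2 (by exact_mod_cast h2))
    have := Finset.card_le_card this
    rw [Finset.card_range] at this
    omega
  · refine le_seqRearrangement f (A := Finset.range (n + 1)) (by simp) fun k hk => ?_
    have : ‖f n‖₊ ≤ ‖f k‖₊ := hf (by simpa [Nat.lt_succ_iff] using hk)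
    exact_mod_cast this

/-- The index of a smallest value on `A` contributes at most `f* (#A - 1)`; removing it and
iterating bounds the whole sum. -/
theorem sum_le_sum_seqRearrangement (f : ℕ → ℂ) (n : ℕ) (A : Finset ℕ) (hA : A.card ≤ n) :
    ∑ k ∈ A, (‖f k‖₊ : ℝ≥0∞) ≤ ∑ k ∈ Finset.range n, seqRearrangement f k := by
  induction n generalizing A with
  | zero => simp [Finset.card_eq_zero.1 (Nat.le_zero.1 hA)]
  | succ n ih =>
    rcases Nat.lt_or_ge A.card (n + 1) with h | h
    · refine (ih A (by omega)).trans ?_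
      rw [Finset.sum_range_succ]
      exact le_self_add
    · have hne : A.Nonempty := Finset.card_pos.1 (by omega)
      obtain ⟨a, ha, hmin⟩ := A.exists_min_image (fun k => ‖f k‖₊) hne
      rw [← Finset.sum_erase_add _ _ ha, Finset.sum_range_succ]
      refine add_le_add (ih _ (by rw [Finset.card_erase_of_mem ha]; omega)) ?_
      exact le_seqRearrangement f (A := A) (by omega) fun k hk => by exact_mod_cast hmin k hk

theorem nnnorm_le_seqRearrangement_zero (f : ℕ → ℂ) (k : ℕ) :
    (‖f k‖₊ : ℝ≥0∞) ≤ seqRearrangement f 0 :=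
  le_seqRearrangement f (A := {k}) (by simp) (by simp)

theorem seqRearrangement_zero (f : ℕ → ℂ) :
    seqRearrangement f 0 = ⨆ k, (‖f k‖₊ : ℝ≥0∞) := by
  refine le_antisymm ?_ (iSup_le (nnnorm_le_seqRearrangement_zero f))
  refine le_of_forall_lt fun t ht => ?_
  obtain ⟨u, hu, hu'⟩ := exists_between ht
  obtain ⟨A, hA, hAt⟩ := exists_finset_of_lt_seqRearrangement f hu'
  obtain ⟨k, hk⟩ : A.Nonempty := Finset.card_pos.1 (by omega)
  exact hu.trans_le ((hAt k hk).trans (le_iSup (fun k => (‖f k‖₊ : ℝ≥0∞)) k))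

/-- Hardy's lemma. Subtracting the last value of `h` from all of them splits off a multiple of
the inequality between the full sums. -/
theorem sum_mul_le_sum_mul_of_antitone (N : ℕ) {a b h : ℕ → ℝ≥0∞} (hh : Antitone h)
    (hab : ∀ L ≤ N, ∑ k ∈ Finset.range L, a k ≤ ∑ k ∈ Finset.range L, b k) :
    ∑ k ∈ Finset.range N, a k * h k ≤ ∑ k ∈ Finset.range N, b k * h k := by
  induction N generalizing h with
  | zero => simp
  | succ N ih =>
    have key : ∀ c : ℕ → ℝ≥0∞, ∑ k ∈ Finset.range (N + 1), c k * h k =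
        ∑ k ∈ Finset.range N, c k * (h k - h N) + (∑ k ∈ Finset.range (N + 1), c k) * h N := by
      intro c
      rw [Finset.sum_range_succ, Finset.sum_range_succ, add_mul, ← add_assoc, Finset.sum_mul,
        ← Finset.sum_add_distrib]
      congr 1
      refine Finset.sum_congr rfl fun k hk => ?_
      rw [← mul_add, tsub_add_cancel_of_le (hh (Finset.mem_range.1 hk).le)]
    rw [key, key]
    have h2 := hab (N + 1) le_rfl
    exact add_le_add (ih (fun i j hij => tsub_le_tsub_right (hh hij) _)
      fun L hL => hab L (by omega)) (by gcongr)

/-! ### Normability -/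

theorem lorentzSeqNorm_eq_zero {Ω : ℕ → ℝ≥0} (hΩ : Ω 0 ≠ 0) {p : ℝ} (hp : 0 < p) {f : ℕ → ℂ}
    (h : lorentzSeqNorm Ω p f = 0) : f = 0 := by
  unfold lorentzSeqNorm at h
  rw [ENNReal.rpow_eq_zero_iff_of_pos (by positivity), ENNReal.tsum_eq_zero] at h
  have h0 := h 0
  rw [mul_eq_zero, ENNReal.rpow_eq_zero_iff_of_pos hp] at h0
  have h1 := h0.resolve_right (by exact_mod_cast hΩ)
  ext k
  have := nnnorm_le_seqRearrangement_zero f k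
  rw [h1] at this
  simpa using this

/-- It suffices to find an equivalent norm with values in `[0, ∞]` on all sequences. -/
theorem LorentzSeqNormable.of_equivalent {Ω : ℕ → ℝ≥0} (hΩ : Ω 0 ≠ 0) {p : ℝ} (hp : 0 < p)
    (M : (ℕ → ℂ) → ℝ≥0∞) (hadd : ∀ f g, M (f + g) ≤ M f + M g)
    (hsmul : ∀ (c : ℂ) f, M (c • f) = ‖c‖₊ * M f) (C : ℝ≥0)
    (h1 : ∀ f, M f ≤ C * lorentzSeqNorm Ω p f) (h2 : ∀ f, lorentzSeqNorm Ω p f ≤ C * M f) :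
    LorentzSeqNormable Ω p := by
  have hfin : ∀ f, lorentzSeqNorm Ω p f < ∞ ↔ M f < ∞ := fun f =>
    ⟨fun h => (h1 f).trans_lt (ENNReal.mul_lt_top ENNReal.coe_lt_top h),
      fun h => (h2 f).trans_lt (ENNReal.mul_lt_top ENNReal.coe_lt_top h)⟩
  let V : Submodule ℂ (ℕ → ℂ) :=
    { carrier := lorentzSeq Ω p
      add_mem' := fun {f g} hf hg => (hfin _).2 <| (hadd f g).trans_lt
        (ENNReal.add_lt_top.2 ⟨(hfin f).1 hf, (hfin g).1 hg⟩)
      zero_mem' := (hfin 0).2 <| by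
        have := hsmul 0 0
        simp only [smul_zero, nnnorm_zero, ENNReal.coe_zero, zero_mul] at this
        simp [this]
      smul_mem' := fun c f hf => (hfin _).2 <| by
        rw [hsmul]
        exact ENNReal.mul_lt_top ENNReal.coe_lt_top ((hfin f).1 hf) }
  have hV : ∀ f : V, M f ≠ ∞ := fun f => ((hfin f).1 f.2).ne
  let N : Seminorm ℂ V := Seminorm.of (fun f => (M f).toReal)
    (fun f g => by
      rw [← ENNReal.toReal_add (hV f) (hV g)]
      exact ENNReal.toReal_mono (ENNReal.add_ne_top.2 ⟨hV f, hV g⟩) (hadd f g))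
    (fun c f => by
      have : ((c • f : V) : ℕ → ℂ) = c • (f : ℕ → ℂ) := rfl
      simp [this, hsmul])
  have hN : ∀ f : V, ENNReal.ofReal (N f) = M f := fun f => ENNReal.ofReal_toReal (hV f)
  refine ⟨V, rfl, N, fun f hf => ?_, C, fun f => ?_⟩
  · have h0 : M f = 0 := by rw [← hN, hf, ENNReal.ofReal_zero]
    have := h2 f
    rw [h0, mul_zero] at this
    exact Subtype.ext (lorentzSeqNorm_eq_zero hΩ hp (le_antisymm this zero_le))
  · rw [hN]
    exact ⟨h1 f, h2 f⟩

/-- In a normable space the functional is subadditive up to a constant, uniformly in the number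
of summands. -/
theorem LorentzSeqNormable.exists_norm_sum_le {Ω : ℕ → ℝ≥0} {p : ℝ}
    (h : LorentzSeqNormable Ω p) :
    ∃ K : ℝ≥0, ∀ (s : Finset ℕ) (f : ℕ → ℕ → ℂ), (∀ j, lorentzSeqNorm Ω p (f j) < ∞) →
      lorentzSeqNorm Ω p (∑ j ∈ s, f j) ≤ K * ∑ j ∈ s, lorentzSeqNorm Ω p (f j) := by
  obtain ⟨V, hV, N, -, C, hC⟩ := h
  refine ⟨C * C, fun s f hf => ?_⟩
  have hm : ∀ j, f j ∈ V := fun j => by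
    rw [← SetLike.mem_coe, hV]
    exact hf j
  let F : ℕ → V := fun j => ⟨f j, hm j⟩
  have hsum : ((∑ j ∈ s, F j : V) : ℕ → ℂ) = ∑ j ∈ s, f j := by
    simp [F]
  have h1 := (hC (∑ j ∈ s, F j)).2
  rw [hsum] at h1
  have h2 : N (∑ j ∈ s, F j) ≤ ∑ j ∈ s, N (F j) :=
    Finset.le_sum_of_subadditive N (map_zero N).le (map_add_le_add N) s F
  calc _ ≤ (C : ℝ≥0∞) * ENNReal.ofReal (N (∑ j ∈ s, F j)) := h1
    _ ≤ C * ∑ j ∈ s, ENNReal.ofReal (N (F j)) := by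
        rw [← ENNReal.ofReal_sum_of_nonneg fun j _ => apply_nonneg N _]
        gcongr
    _ ≤ C * ∑ j ∈ s, C * lorentzSeqNorm Ω p (f j) := by
        gcongr with j _
        exact (hC (F j)).1
    _ = _ := by rw [← Finset.mul_sum, ENNReal.coe_mul, mul_assoc]

theorem lorentzSeqNorm_comp_le (Ω : ℕ → ℝ≥0) {p : ℝ} (hp : 0 < p) (f : ℕ → ℂ) {σ : ℕ → ℕ}
    (hσ : Function.Injective σ) : lorentzSeqNorm Ω p (f ∘ σ) ≤ lorentzSeqNorm Ω p f := by
  unfold lorentzSeqNorm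
  gcongr
  exact seqRearrangement_comp_le f hσ _

theorem lorentzSeqNorm_of_antitone (Ω : ℕ → ℝ≥0) {p : ℝ} (hp : 0 < p) {g : ℕ → ℝ≥0}
    (hg : Antitone g) (n : ℕ) (h0 : ∀ k, n ≤ k → g k = 0) :
    lorentzSeqNorm Ω p (fun k => ((g k : ℝ) : ℂ)) =
      ((∑ k ∈ Finset.range n, g k ^ p * Ω k) ^ (1 / p) : ℝ≥0) := by
  have hn : ∀ k, ‖((g k : ℝ) : ℂ)‖₊ = g k := fun k => by
    ext
    simp
  have hr : ∀ k, seqRearrangement (fun k => ((g k : ℝ) : ℂ)) k = g k := fun k => by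
    rw [seqRearrangement_of_antitone (by simpa only [hn] using hg), hn]
  unfold lorentzSeqNorm
  simp only [hr]
  rw [tsum_eq_sum (s := Finset.range n), ENNReal.coe_rpow_of_nonneg _ (by positivity)]
  · push_cast
    simp only [ENNReal.coe_rpow_of_nonneg _ hp.le]
  · intro k hk
    rw [h0 k (by simpa using hk)]
    simp [ENNReal.zero_rpow_of_pos hp]

/-! ### Averaging over cyclic shifts -/

theorem sum_range_add_mod {M : Type*} [AddCommMonoid M] (g : ℕ → M) {n : ℕ} (k : ℕ) :
    ∑ i ∈ Finset.range n, g ((k + i) % n) = ∑ i ∈ Finset.range n, g i := by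
  rcases Nat.eq_zero_or_pos n with rfl | hn
  · simp
  have hinj : Set.InjOn (fun i => (k + i) % n) (Finset.range n) := by
    intro i hi j hj hij
    simp only [Finset.coe_range, Set.mem_Iio] at hi hj
    have : k + i ≡ k + j [MOD n] := hij
    have := Nat.ModEq.add_left_cancel' k this
    exact Nat.ModEq.eq_of_lt_of_lt this hi hj
  have himg : (Finset.range n).image (fun i => (k + i) % n) = Finset.range n := by
    refine Finset.eq_of_subset_of_card_le (fun x hx => ?_) ?_
    · obtain ⟨i, -, rfl⟩ := Finset.mem_image.1 hx
      exact Finset.mem_range.2 (Nat.mod_lt _ hn)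
    · rw [Finset.card_image_of_injOn hinj]
  conv_rhs => rw [← himg]
  rw [Finset.sum_image hinj]

theorem cyclicShift_injective (n i : ℕ) :
    Function.Injective fun k => if k < n then (k + i) % n else k := by
  intro a b hab
  dsimp only at hab
  split_ifs at hab with h1 h2 h2
  · have : a + i ≡ b + i [MOD n] := hab
    exact Nat.ModEq.eq_of_lt_of_lt (Nat.ModEq.add_right_cancel' i this) h1 h2
  · have := Nat.mod_lt (a + i) (by omega : 0 < n)
    omega
  · have := Nat.mod_lt (b + i) (by omega : 0 < n)
    omega
  · exact hab

/-- The `n` cyclic shifts of a sequence supported on `[0, n)` have the same rearrangement, and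
their sum is a multiple of the indicator of `[0, n)`. -/
theorem LorentzSeqNormable.exists_averaging {Ω : ℕ → ℝ≥0} {p : ℝ} (hp : 0 < p)
    (h : LorentzSeqNormable Ω p) :
    ∃ K : ℝ≥0, ∀ (n : ℕ) (g : ℕ → ℝ≥0), Antitone g → (∀ k, n ≤ k → g k = 0) →
      (∑ k ∈ Finset.range n, g k) * (∑ k ∈ Finset.range n, Ω k) ^ (1 / p) ≤
        K * n * (∑ k ∈ Finset.range n, g k ^ p * Ω k) ^ (1 / p) := by
  obtain ⟨K, hK⟩ := h.exists_norm_sum_le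
  refine ⟨K, fun n g hg h0 => ?_⟩
  set f : ℕ → ℂ := fun k => ((g k : ℝ) : ℂ) with hf
  have hnorm := lorentzSeqNorm_of_antitone Ω hp hg n h0
  let F : ℕ → ℕ → ℂ := fun i => f ∘ fun k => if k < n then (k + i) % n else k
  have hF : ∀ i, lorentzSeqNorm Ω p (F i) ≤ lorentzSeqNorm Ω p f := fun i =>
    lorentzSeqNorm_comp_le Ω hp f (cyclicShift_injective n i)
  let c : ℝ≥0 := ∑ k ∈ Finset.range n, g k
  let χ : ℕ → ℝ≥0 := fun k => if k < n then c else 0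
  have hχ : Antitone χ := fun i j hij => by
    simp only [χ]
    split_ifs <;> first | omega | simp
  have hsum : ∑ i ∈ Finset.range n, F i = fun k => ((χ k : ℝ) : ℂ) := by
    ext k
    rw [Finset.sum_apply]
    by_cases hk : k < n
    · simp only [F, Function.comp, χ, hk, if_true]
      rw [sum_range_add_mod f k]
      simp [hf, c]
    · simp [F, χ, hk, hf, h0 k (not_lt.1 hk)]
  have hmain := hK (Finset.range n) F fun i =>
    (hF i).trans_lt (by rw [hnorm]; exact ENNReal.coe_lt_top)
  rw [hsum, lorentzSeqNorm_of_antitone Ω hp hχ n fun k hk => by simp [χ, hk]] at hmain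
  have h2 : ∑ i ∈ Finset.range n, lorentzSeqNorm Ω p (F i) ≤ n * lorentzSeqNorm Ω p f := by
    refine (Finset.sum_le_sum fun i _ => hF i).trans ?_
    simp
  have h3 := hmain.trans (mul_le_mul_right h2 K)
  rw [hnorm] at h3
  have h4 : (∑ k ∈ Finset.range n, χ k ^ p * Ω k) ^ (1 / p) ≤
      K * (n * (∑ k ∈ Finset.range n, g k ^ p * Ω k) ^ (1 / p)) := by exact_mod_cast h3
  have h5 : ∑ k ∈ Finset.range n, χ k ^ p * Ω k = c ^ p * ∑ k ∈ Finset.range n, Ω k := by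
    rw [Finset.mul_sum]
    refine Finset.sum_congr rfl fun k hk => ?_
    simp [χ, Finset.mem_range.1 hk]
  rw [h5, NNReal.mul_rpow, ← NNReal.rpow_mul, mul_one_div_cancel hp.ne', NNReal.rpow_one,
    ← mul_assoc] at h4
  exact h4

/-! ### Exponents below one -/

theorem lorentzSeqNorm_le_of_summable {Ω : ℕ → ℝ≥0} (h : Summable Ω) {p : ℝ} (hp : 0 < p)
    (f : ℕ → ℂ) :
    lorentzSeqNorm Ω p f ≤ ((∑' n, Ω n) ^ (1 / p) : ℝ≥0) * seqRearrangement f 0 := by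
  have h1 : ∑' n, seqRearrangement f n ^ p * (Ω n : ℝ≥0∞) ≤
      seqRearrangement f 0 ^ p * ((∑' n, Ω n : ℝ≥0) : ℝ≥0∞) := by
    rw [ENNReal.coe_tsum h, ← ENNReal.tsum_mul_left]
    gcongr with n
    exact seqRearrangement_antitone f (Nat.zero_le n)
  unfold lorentzSeqNorm
  refine (ENNReal.rpow_le_rpow h1 (by positivity)).trans_eq ?_
  rw [ENNReal.mul_rpow_of_nonneg _ _ (by positivity), ← ENNReal.rpow_mul,
    mul_one_div_cancel hp.ne', ENNReal.rpow_one, ENNReal.coe_rpow_of_nonneg _ (by positivity),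
    mul_comm]

theorem mul_seqRearrangement_zero_le_lorentzSeqNorm (Ω : ℕ → ℝ≥0) {p : ℝ} (hp : 0 < p)
    (f : ℕ → ℂ) :
    ((Ω 0 ^ (1 / p) : ℝ≥0) : ℝ≥0∞) * seqRearrangement f 0 ≤ lorentzSeqNorm Ω p f := by
  have h1 := ENNReal.le_tsum (f := fun n => seqRearrangement f n ^ p * (Ω n : ℝ≥0∞)) 0
  unfold lorentzSeqNorm
  refine le_trans (le_of_eq ?_) (ENNReal.rpow_le_rpow h1 (by positivity))
  rw [ENNReal.mul_rpow_of_nonneg _ _ (by positivity), ← ENNReal.rpow_mul,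
    mul_one_div_cancel hp.ne', ENNReal.rpow_one, ENNReal.coe_rpow_of_nonneg _ (by positivity),
    mul_comm]

theorem seqRearrangement_zero_le_lorentzSeqNorm {Ω : ℕ → ℝ≥0} (hΩ : Ω 0 ≠ 0) {p : ℝ}
    (hp : 0 < p) (f : ℕ → ℂ) :
    seqRearrangement f 0 ≤ ((Ω 0 ^ (1 / p))⁻¹ : ℝ≥0) * lorentzSeqNorm Ω p f := by
  have h0 : Ω 0 ^ (1 / p) ≠ 0 := by simp [NNReal.rpow_eq_zero_iff, hΩ]
  calc seqRearrangement f 0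
      = ((Ω 0 ^ (1 / p))⁻¹ : ℝ≥0) * (((Ω 0 ^ (1 / p) : ℝ≥0) : ℝ≥0∞) * seqRearrangement f 0) := by
        rw [← mul_assoc, ← ENNReal.coe_mul, inv_mul_cancel₀ h0, ENNReal.coe_one, one_mul]
    _ ≤ _ := by
        gcongr
        exact mul_seqRearrangement_zero_le_lorentzSeqNorm Ω hp f

theorem lorentzSeqNormable_of_summable {Ω : ℕ → ℝ≥0} (hΩ : Ω 0 ≠ 0) (h : Summable Ω) {p : ℝ}
    (hp : 0 < p) : LorentzSeqNormable Ω p := by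
  refine LorentzSeqNormable.of_equivalent hΩ hp (fun f => ⨆ k, (‖f k‖₊ : ℝ≥0∞)) ?_ ?_
    ((Ω 0 ^ (1 / p))⁻¹ + (∑' n, Ω n) ^ (1 / p)) ?_ ?_
  · refine fun f g => iSup_le fun k => ?_
    refine le_trans ?_ (add_le_add (le_iSup (fun k => (‖f k‖₊ : ℝ≥0∞)) k)
      (le_iSup (fun k => (‖g k‖₊ : ℝ≥0∞)) k))
    exact_mod_cast nnnorm_add_le (f k) (g k)
  · intro c f
    rw [ENNReal.mul_iSup]
    simp
  · intro f
    rw [← seqRearrangement_zero]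
    refine (seqRearrangement_zero_le_lorentzSeqNorm hΩ hp f).trans ?_
    gcongr
    exact le_self_add
  · intro f
    rw [← seqRearrangement_zero]
    refine (lorentzSeqNorm_le_of_summable h hp f).trans ?_
    gcongr
    exact le_add_self

theorem lorentzSeq_eq_of_summable {Ω : ℕ → ℝ≥0} (hΩ : Ω 0 ≠ 0) (h : Summable Ω) {p : ℝ}
    (hp : 0 < p) : lorentzSeq Ω p = {f : ℕ → ℂ | Memℓp f ∞} := by
  ext f
  have h1 : lorentzSeqNorm Ω p f < ∞ ↔ seqRearrangement f 0 < ∞ :=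
    ⟨fun hf => (seqRearrangement_zero_le_lorentzSeqNorm hΩ hp f).trans_lt
      (ENNReal.mul_lt_top ENNReal.coe_lt_top hf),
    fun hf => (lorentzSeqNorm_le_of_summable h hp f).trans_lt
      (ENNReal.mul_lt_top ENNReal.coe_lt_top hf)⟩
  simp only [lorentzSeq, Set.mem_ofPred_eq, memℓp_infty_iff]
  rw [h1, seqRearrangement_zero]
  have := ENNReal.iSup_coe_lt_top (f := fun k => ‖f k‖₊)
  rw [this, ← NNReal.bddAbove_coe, ← Set.range_comp]
  rfl

/-- When the weight of `[0, n j)` at least doubles with `j`, the normalised indicators of these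
intervals add up to a sequence whose functional is at least of the order of `J ^ (1 / p)`. -/
theorem summable_of_lorentzSeqNormable {Ω : ℕ → ℝ≥0} (hΩ : Ω 0 ≠ 0) {p : ℝ} (hp : 0 < p)
    (hp1 : p < 1) (h : LorentzSeqNormable Ω p) : Summable Ω := by
  by_contra hns
  obtain ⟨K, hK⟩ := h.exists_norm_sum_le
  set A : ℕ → ℝ≥0 := fun L => ∑ k ∈ Finset.range L, Ω k with hA
  have hAmono : Monotone A := fun i j hij =>
    Finset.sum_le_sum_of_subset (Finset.range_mono hij)
  have htop : Filter.Tendsto A Filter.atTop Filter.atTop :=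
    (NNReal.not_summable_iff_tendsto_nat_atTop).1 hns
  have hstep : ∀ L : ℕ, ∃ M : ℕ, L ≤ M ∧ 2 * A L ≤ A M := fun L => by
    obtain ⟨M, h1, h2⟩ := ((htop.eventually_ge_atTop (2 * A L)).and
      (Filter.eventually_ge_atTop L)).exists
    exact ⟨M, h2, h1⟩
  choose nx hnx1 hnx2 using hstep
  let n : ℕ → ℕ := fun j => nx^[j] 1
  have hnS : ∀ j, n (j + 1) = nx (n j) := fun j => Function.iterate_succ_apply' nx j 1
  have hnmono : Monotone n := monotone_nat_of_le_succ fun j => by rw [hnS]; exact hnx1 _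
  have hApos : ∀ j, A (n j) ≠ 0 := fun j => by
    have h1 : A (n 0) ≤ A (n j) := hAmono (hnmono (Nat.zero_le j))
    have h2 : A (n 0) = Ω 0 := by simp [hA, n]
    rw [h2] at h1
    exact (lt_of_lt_of_le (pos_iff_ne_zero.2 hΩ) h1).ne'
  let c : ℕ → ℝ≥0 := fun j => (A (n j))⁻¹ ^ (1 / p)
  have hcp : ∀ j, c j ^ p = (A (n j))⁻¹ := fun j => by
    simp only [c]
    rw [← NNReal.rpow_mul, one_div_mul_cancel hp.ne', NNReal.rpow_one]
  let χ : ℕ → ℕ → ℝ≥0 := fun j k => if k < n j then c j else 0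
  have hχ : ∀ j, Antitone (χ j) := fun j a b hab => by
    simp only [χ]
    split_ifs <;> first | omega | simp
  have hχn : ∀ j, lorentzSeqNorm Ω p (fun k => ((χ j k : ℝ) : ℂ)) = 1 := fun j => by
    rw [lorentzSeqNorm_of_antitone Ω hp (hχ j) (n j) fun k hk => by simp [χ, hk]]
    have : ∑ k ∈ Finset.range (n j), χ j k ^ p * Ω k = 1 := by
      rw [← inv_mul_cancel₀ (hApos j), Finset.mul_sum]
      refine Finset.sum_congr rfl fun k hk => ?_
      simp [χ, Finset.mem_range.1 hk, hcp]
    simp [this]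
  let g : ℕ → ℕ → ℝ≥0 := fun J k => ∑ j ∈ Finset.range J, χ j k
  have hg : ∀ J, Antitone (g J) := fun J a b hab => Finset.sum_le_sum fun j _ => hχ j hab
  have hg0 : ∀ J k, n J ≤ k → g J k = 0 := fun J k hk => Finset.sum_eq_zero fun j hj => by
    have := hnmono (Finset.mem_range.1 hj).le
    simp [χ, this.trans hk]
  -- each step adds the indices in `[n J, n (J + 1))`, which carry at least half of `A (n (J + 1))`
  have hlow : ∀ J : ℕ, (J : ℝ≥0) / 2 ≤ ∑ k ∈ Finset.range (n J), g (J + 1) k ^ p * Ω k := by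
    intro J
    induction J with
    | zero => simp
    | succ J ih =>
      have hle := hnmono (Nat.le_succ J)
      rw [← Finset.sum_range_add_sum_Ico _ hle]
      have hI : (1 : ℝ≥0) / 2 ≤
          ∑ k ∈ Finset.Ico (n J) (n (J + 1)), g (J + 2) k ^ p * Ω k := by
        have h1 : (A (n (J + 1)))⁻¹ * ∑ k ∈ Finset.Ico (n J) (n (J + 1)), Ω k ≤
            ∑ k ∈ Finset.Ico (n J) (n (J + 1)), g (J + 2) k ^ p * Ω k := by
          rw [Finset.mul_sum]
          refine Finset.sum_le_sum fun k hk => ?_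
          gcongr
          rw [← hcp]
          gcongr
          have h3 : χ (J + 1) k = c (J + 1) := by simp [χ, (Finset.mem_Ico.1 hk).2]
          rw [← h3]
          exact Finset.single_le_sum (f := fun j => χ j k) (fun _ _ => zero_le)
            (Finset.mem_range.2 (by omega))
        refine le_trans ?_ h1
        have h4 : A (n J) + ∑ k ∈ Finset.Ico (n J) (n (J + 1)), Ω k = A (n (J + 1)) :=
          Finset.sum_range_add_sum_Ico _ hle
        have h5 : 2 * A (n J) ≤ A (n (J + 1)) := by rw [hnS]; exact hnx2 _
        have h6 : A (n (J + 1)) / 2 ≤ ∑ k ∈ Finset.Ico (n J) (n (J + 1)), Ω k := by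
          rw [← NNReal.coe_le_coe] at h5 ⊢
          rw [← NNReal.coe_inj] at h4
          push_cast at h4 h5 ⊢
          linarith
        calc (1 : ℝ≥0) / 2 = (A (n (J + 1)))⁻¹ * (A (n (J + 1)) / 2) := by
              rw [mul_div, inv_mul_cancel₀ (hApos _)]
          _ ≤ _ := by gcongr
      have hR : (J : ℝ≥0) / 2 ≤ ∑ k ∈ Finset.range (n J), g (J + 2) k ^ p * Ω k := by
        refine ih.trans (Finset.sum_le_sum fun k _ => ?_)
        gcongr
        exact Finset.sum_le_sum_of_subset (Finset.range_mono (by omega))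
      push_cast
      rw [add_div]
      exact add_le_add hR hI
  have hup : ∀ J : ℕ, ((J : ℝ≥0) / 2) ^ (1 / p) ≤ K * (J + 1) := by
    intro J
    have h1 := hK (Finset.range (J + 1)) (fun j k => ((χ j k : ℝ) : ℂ))
      fun j => by rw [hχn]; exact ENNReal.one_lt_top
    have h2 : (∑ j ∈ Finset.range (J + 1), fun k => ((χ j k : ℝ) : ℂ)) =
        fun k => ((g (J + 1) k : ℝ) : ℂ) := by
      ext k
      simp [Finset.sum_apply, g]
    rw [h2, lorentzSeqNorm_of_antitone Ω hp (hg _) _ (hg0 (J + 1))] at h1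
    simp only [hχn, Finset.sum_const, Finset.card_range, nsmul_eq_mul, mul_one] at h1
    have h3 : (∑ k ∈ Finset.range (n (J + 1)), g (J + 1) k ^ p * Ω k) ^ (1 / p) ≤
        K * ((J + 1 : ℕ) : ℝ≥0) := by exact_mod_cast h1
    push_cast at h3
    refine le_trans ?_ h3
    gcongr
    exact (hlow J).trans (Finset.sum_le_sum_of_subset
      (Finset.range_mono (hnmono (Nat.le_succ J))))
  -- `J ^ (1 / p)` outgrows `J`
  have hpp : 0 < 1 / p - 1 := by
    rw [sub_pos, lt_div_iff₀ hp]
    linarith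
  have hlim := (tendsto_rpow_atTop hpp).comp
    (tendsto_natCast_atTop_atTop (R := ℝ))
  obtain ⟨J, hJ, hJ1⟩ := ((hlim.eventually_gt_atTop (2 ^ (1 / p) * (2 * (K : ℝ)))).and
    (Filter.eventually_ge_atTop 1)).exists
  have h1 := hup J
  rw [← NNReal.coe_le_coe] at h1
  push_cast at h1
  have hJ0 : (1 : ℝ) ≤ J := by exact_mod_cast hJ1
  rw [Real.div_rpow (by positivity) (by positivity), div_le_iff₀ (by positivity)] at h1
  have h2 : (J : ℝ) ^ (1 / p) = (J : ℝ) ^ (1 / p - 1) * J := by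
    rw [← Real.rpow_add_one (by positivity)]
    congr 1
    ring
  rw [h2] at h1
  simp only [Function.comp] at hJ
  have h3 : (2 : ℝ) ^ (1 / p) * (2 * K) * J < (J : ℝ) ^ (1 / p - 1) * J := by gcongr
  have h4 : (0 : ℝ) ≤ (K : ℝ) * 2 ^ (1 / p) := by positivity
  nlinarith [mul_le_mul_of_nonneg_left hJ0 h4]

/-! ### The exponent one -/

/-- The functional `sup ∑ |f (σ n)| w n` over finite partial injections `σ` of `ℕ`. As a supremum
of seminorms it is subadditive for every weight; for a nonincreasing weight it is equivalent to
`∑ f* n w n`. -/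
noncomputable def injectionNorm (w : ℕ → ℝ≥0) (f : ℕ → ℂ) : ℝ≥0∞ :=
  ⨆ (N : ℕ) (σ : ℕ → ℕ) (_ : Set.InjOn σ (Finset.range N)),
    ∑ n ∈ Finset.range N, (‖f (σ n)‖₊ : ℝ≥0∞) * w n

theorem le_injectionNorm (w : ℕ → ℝ≥0) (f : ℕ → ℂ) {N : ℕ} {σ : ℕ → ℕ}
    (hσ : Set.InjOn σ (Finset.range N)) :
    ∑ n ∈ Finset.range N, (‖f (σ n)‖₊ : ℝ≥0∞) * w n ≤ injectionNorm w f :=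
  le_iSup_of_le N (le_iSup_of_le σ (le_iSup_of_le hσ le_rfl))

theorem injectionNorm_add_le (w : ℕ → ℝ≥0) (f g : ℕ → ℂ) :
    injectionNorm w (f + g) ≤ injectionNorm w f + injectionNorm w g := by
  refine iSup_le fun N => iSup_le fun σ => iSup_le fun hσ => ?_
  refine le_trans ?_ (add_le_add (le_injectionNorm w f hσ) (le_injectionNorm w g hσ))
  rw [← Finset.sum_add_distrib]
  refine Finset.sum_le_sum fun n _ => ?_
  rw [← add_mul]
  gcongr
  exact_mod_cast nnnorm_add_le (f (σ n)) (g (σ n))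

theorem injectionNorm_smul (w : ℕ → ℝ≥0) (c : ℂ) (f : ℕ → ℂ) :
    injectionNorm w (c • f) = ‖c‖₊ * injectionNorm w f := by
  simp only [injectionNorm, ENNReal.mul_iSup, Finset.mul_sum, Pi.smul_apply, nnnorm_smul,
    ENNReal.coe_mul, mul_assoc]

theorem injectionNorm_le {w : ℕ → ℝ≥0} (hw : Antitone w) (f : ℕ → ℂ) :
    injectionNorm w f ≤ ∑' n, seqRearrangement f n * (w n : ℝ≥0∞) := by
  refine iSup_le fun N => iSup_le fun σ => iSup_le fun hσ => ?_
  refine le_trans ?_ (ENNReal.sum_le_tsum (Finset.range N))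
  refine sum_mul_le_sum_mul_of_antitone N (fun i j hij => by exact_mod_cast hw hij)
    fun L hL => ?_
  have hinj : Set.InjOn σ (Finset.range L) := hσ.mono (by
    exact_mod_cast Finset.range_mono hL)
  rw [← Finset.sum_image (f := fun k => (‖f k‖₊ : ℝ≥0∞)) hinj]
  exact sum_le_sum_seqRearrangement f L _ (Finset.card_image_le.trans (by simp))

/-- A greedy choice: there are more than `n` indices at a level below `f* n`, so one of them is
still unused after `n` choices. -/
theorem exists_injOn_le (f : ℕ → ℂ) (t : ℕ → ℝ≥0∞)
    (ht : ∀ n, t n < seqRearrangement f n ∨ t n = 0) (N : ℕ) :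
    ∃ σ : ℕ → ℕ, Set.InjOn σ (Finset.range N) ∧ ∀ n < N, t n ≤ ‖f (σ n)‖₊ := by
  induction N with
  | zero => exact ⟨id, by simp, by simp⟩
  | succ N ih =>
    obtain ⟨σ, hσ, hle⟩ := ih
    obtain ⟨k, hk, hkt⟩ : ∃ k, k ∉ (Finset.range N).image σ ∧ t N ≤ ‖f k‖₊ := by
      rcases ht N with h | h
      · obtain ⟨A, hA, hAt⟩ := exists_finset_of_lt_seqRearrangement f h
        obtain ⟨k, hkA, hk⟩ := Finset.exists_mem_notMem_of_card_lt_card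
          (s := (Finset.range N).image σ) (t := A)
          (lt_of_le_of_lt Finset.card_image_le (by simp [hA]))
        exact ⟨k, hk, hAt k hkA⟩
      · obtain ⟨k, hk⟩ := Infinite.exists_notMem_finset ((Finset.range N).image σ)
        exact ⟨k, hk, by simp [h]⟩
    have hold : ∀ n < N, Function.update σ N k n = σ n := fun n hn =>
      Function.update_of_ne hn.ne _ _
    have hnew : ∀ n < N, σ n ≠ k := fun n hn h =>
      hk (Finset.mem_image.2 ⟨n, Finset.mem_range.2 hn, h⟩)
    refine ⟨Function.update σ N k, fun i hi j hj hij => ?_, fun n hn => ?_⟩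
    · simp only [Finset.coe_range, Set.mem_Iio] at hi hj
      rcases (Nat.lt_succ_iff_lt_or_eq).1 hi with hi' | rfl <;>
        rcases (Nat.lt_succ_iff_lt_or_eq).1 hj with hj' | hj'
      · rw [hold i hi', hold j hj'] at hij
        exact hσ (by simpa using hi') (by simpa using hj') hij
      · subst hj'
        rw [hold i hi', Function.update_self] at hij
        exact absurd hij (hnew i hi')
      · rw [hold j hj', Function.update_self] at hij
        exact absurd hij.symm (hnew j hj')
      · exact hj'.symm
    · rcases (Nat.lt_succ_iff_lt_or_eq).1 hn with hn' | rfl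
      · rw [hold n hn']
        exact hle n hn'
      · rwa [Function.update_self]

theorem tsum_le_two_mul_injectionNorm {w : ℕ → ℝ≥0} (hw0 : w 0 ≠ 0) (f : ℕ → ℂ) :
    ∑' n, seqRearrangement f n * (w n : ℝ≥0∞) ≤ 2 * injectionNorm w f := by
  have hw0' : (w 0 : ℝ≥0∞) ≠ 0 := by exact_mod_cast hw0
  by_cases hf : seqRearrangement f 0 = ∞
  · -- evaluating at a single index already shows that both sides are infinite
    have h1 : seqRearrangement f 0 * w 0 ≤ injectionNorm w f := by
      rw [seqRearrangement_zero, ENNReal.iSup_mul]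
      refine iSup_le fun k => ?_
      simpa using le_injectionNorm w f (N := 1) (σ := fun _ => k) (by simp)
    rw [hf, ENNReal.top_mul hw0', top_le_iff] at h1
    simp [h1]
  · rw [ENNReal.tsum_eq_iSup_nat]
    refine iSup_le fun N => ?_
    have hfin : ∀ n, seqRearrangement f n ≠ ∞ := fun n =>
      ne_top_of_le_ne_top hf (seqRearrangement_antitone f (Nat.zero_le n))
    obtain ⟨σ, hσ, hle⟩ := exists_injOn_le f (fun n => seqRearrangement f n / 2) (fun n => by
      by_cases h : seqRearrangement f n = 0
      · exact Or.inr (by simp [h])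
      · exact Or.inl (ENNReal.half_lt_self h (hfin n))) N
    refine le_trans ?_ (mul_le_mul_right (le_injectionNorm w f hσ) 2)
    rw [Finset.mul_sum]
    refine Finset.sum_le_sum fun n hn => ?_
    rw [← mul_assoc]
    gcongr
    have h2 := mul_le_mul_right (hle n (Finset.mem_range.1 hn)) 2
    rwa [ENNReal.mul_div_cancel (by norm_num) (by norm_num)] at h2

/-- A nondecreasing `A` for which `A n / n` is almost decreasing is equivalent to the concave
sequence `n ↦ inf_m A m (1 + n / m)`, an infimum of affine functions, and hence to the sequence of
partial sums of a nonincreasing weight. -/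
theorem exists_antitone_weight {A : ℕ → ℝ} (hA : Monotone A) (hA1 : 0 < A 1) {C : ℝ}
    (hC1 : 1 ≤ C) (hC : ∀ m n : ℕ, 1 ≤ m → m ≤ n → A n * m ≤ C * n * A m) (hA0 : A 0 = 0) :
    ∃ w : ℕ → ℝ≥0, Antitone w ∧ w 0 ≠ 0 ∧
      ∀ L, ∑ k ∈ Finset.range L, (w k : ℝ) ≤ 2 * A L ∧
        A L ≤ C * ∑ k ∈ Finset.range L, (w k : ℝ) := by
  have hpos : ∀ m, 0 < A (m + 1) := fun m => hA1.trans_le (hA (by omega))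
  let a : ℕ → ℕ → ℝ := fun n m => A (m + 1) * (1 + n / (m + 1))
  have ha : ∀ n m, 0 ≤ a n m := fun n m => by
    have := (hpos m).le
    simp only [a]
    positivity
  have hbdd : ∀ n, BddBelow (Set.range (a n)) := fun n => ⟨0, by rintro _ ⟨m, rfl⟩; exact ha n m⟩
  -- the value at `0` is lowered to `0`, which keeps concavity
  let ψ : ℕ → ℝ := fun n => if n = 0 then 0 else ⨅ m, a n m
  have hψ0 : ψ 0 = 0 := if_pos rfl
  have hψS : ∀ n, ψ (n + 1) = ⨅ m, a (n + 1) m := fun n => if_neg (Nat.succ_ne_zero n)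
  have hψle : ∀ n m, ψ n ≤ a n m := fun n m => by
    rcases n with _ | n
    · rw [hψ0]
      exact ha 0 m
    · rw [hψS]
      exact ciInf_le (hbdd _) m
  have hmono : ∀ n, ψ n ≤ ψ (n + 1) := fun n => by
    rw [hψS]
    refine le_ciInf fun m => (hψle n m).trans ?_
    have := (hpos m).le
    simp only [a]
    gcongr
    omega
  have hconc : ∀ n, ψ (n + 2) + ψ n ≤ 2 * ψ (n + 1) := fun n => by
    have : (ψ (n + 2) + ψ n) / 2 ≤ ψ (n + 1) := by
      rw [hψS n]
      refine le_ciInf fun m => ?_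
      have h1 := hψle (n + 2) m
      have h2 := hψle n m
      have h3 : a (n + 2) m + a n m = 2 * a (n + 1) m := by
        simp only [a]
        push_cast
        ring
      linarith
    linarith
  have hup : ∀ L, ψ L ≤ 2 * A L := fun L => by
    rcases L with _ | L
    · simp [hψ0, hA0]
    · refine (hψle (L + 1) L).trans_eq ?_
      have : (L : ℝ) + 1 ≠ 0 := by positivity
      simp only [a]
      push_cast
      rw [div_self this]
      ring
  have hlow : ∀ L, A L ≤ C * ψ L := fun L => by
    rcases L with _ | L
    · simp [hψ0, hA0]
    · have hC0 : 0 < C := by linarith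
      rw [← div_le_iff₀' hC0, hψS]
      refine le_ciInf fun m => ?_
      rw [div_le_iff₀' hC0]
      have h0 := hpos m
      simp only [a]
      push_cast
      rcases le_total L m with h | h
      · have h1 : A (L + 1) ≤ A (m + 1) := hA (by omega)
        have h2 : (0 : ℝ) ≤ (L + 1) / (m + 1) := by positivity
        have h3 : A (m + 1) ≤ A (m + 1) * (1 + (L + 1) / (m + 1)) := by nlinarith
        have h4 : 0 ≤ A (m + 1) * (1 + ((L : ℝ) + 1) / (m + 1)) := h0.le.trans h3
        nlinarith
      · have h1 := hC (m + 1) (L + 1) (by omega) (by omega)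
        push_cast at h1
        have h2 : A (L + 1) ≤ C * (A (m + 1) * ((L + 1) / (m + 1))) := by
          rw [mul_div, mul_div, le_div_iff₀ (by positivity)]
          linarith
        have h3 : 0 ≤ C * A (m + 1) := by positivity
        linarith
  have hw : ∀ n, ((ψ (n + 1) - ψ n).toNNReal : ℝ) = ψ (n + 1) - ψ n := fun n =>
    Real.coe_toNNReal _ (by linarith [hmono n])
  have hsum : ∀ L, ∑ k ∈ Finset.range L, ((ψ (k + 1) - ψ k).toNNReal : ℝ) = ψ L := fun L => by
    simp only [hw]
    rw [Finset.sum_range_sub, hψ0, sub_zero]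
  refine ⟨fun n => (ψ (n + 1) - ψ n).toNNReal, antitone_nat_of_succ_le fun n => ?_, fun h => ?_,
    fun L => ?_⟩
  · exact Real.toNNReal_le_toNNReal (by linarith [hconc n])
  · have h1 := hw 0
    dsimp only at h
    rw [h, zero_add, hψ0] at h1
    have h2 := hlow 1
    rw [NNReal.coe_zero, sub_zero] at h1
    rw [← h1] at h2
    linarith
  · rw [hsum]
    exact ⟨hup L, hlow L⟩

theorem lorentzSeqNorm_one (Ω : ℕ → ℝ≥0) (f : ℕ → ℂ) :
    lorentzSeqNorm Ω 1 f = ∑' n, seqRearrangement f n * (Ω n : ℝ≥0∞) := by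
  simp [lorentzSeqNorm]

/-- Hardy's lemma for infinite sums against a nonincreasing rearrangement. -/
theorem tsum_seqRearrangement_mul_le {v w : ℕ → ℝ≥0} (C : ℝ≥0)
    (h : ∀ L, ∑ k ∈ Finset.range L, v k ≤ C * ∑ k ∈ Finset.range L, w k) (f : ℕ → ℂ) :
    ∑' n, seqRearrangement f n * (v n : ℝ≥0∞) ≤
      C * ∑' n, seqRearrangement f n * (w n : ℝ≥0∞) := by
  rw [ENNReal.tsum_eq_iSup_nat]
  refine iSup_le fun N => ?_
  refine le_trans ?_ (mul_le_mul_right (ENNReal.sum_le_tsum (Finset.range N)) (C : ℝ≥0∞))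
  have := sum_mul_le_sum_mul_of_antitone N (a := fun n => (v n : ℝ≥0∞))
    (b := fun n => (C : ℝ≥0∞) * w n) (seqRearrangement_antitone f) fun L _ => by
      rw [← Finset.mul_sum]
      exact_mod_cast h L
  rw [Finset.mul_sum]
  refine le_trans (le_of_eq ?_) (this.trans (le_of_eq ?_))
  · exact Finset.sum_congr rfl fun n _ => mul_comm _ _
  · exact Finset.sum_congr rfl fun n _ => by ring

theorem lorentzSeqNormable_one_of_weightSum_le {Ω : ℕ → ℝ≥0} (hΩ : Ω 0 ≠ 0) {C : ℝ≥0}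
    (hC : ∀ m n : ℕ, 0 < m → m < n →
      weightSum Ω n / ((n : ℝ≥0) + 1) ≤ C * (weightSum Ω m / ((m : ℝ≥0) + 1))) :
    LorentzSeqNormable Ω 1 := by
  set A : ℕ → ℝ≥0 := fun L => ∑ k ∈ Finset.range L, Ω k with hA
  have hAmono : Monotone A := fun i j hij =>
    Finset.sum_le_sum_of_subset (Finset.range_mono hij)
  have hA1 : 0 < A 1 := by simpa [hA] using pos_iff_ne_zero.2 hΩ
  have hC2 : ∀ m n : ℕ, 2 ≤ m → m ≤ n → (A n : ℝ) * m ≤ (C + 1) * n * A m := by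
    intro m n hm hmn
    rcases hmn.eq_or_lt with rfl | hlt
    · have : (0 : ℝ) ≤ C * m * A m := by positivity
      nlinarith
    · obtain ⟨m, rfl⟩ := Nat.exists_eq_add_of_le' (show 1 ≤ m by omega)
      obtain ⟨n, rfl⟩ := Nat.exists_eq_add_of_le' (show 1 ≤ n by omega)
      have h1 := hC m n (by omega) (by omega)
      rw [← NNReal.coe_le_coe] at h1
      push_cast at h1
      rw [mul_div, div_le_div_iff₀ (by positivity) (by positivity)] at h1
      have h2 : (0 : ℝ) ≤ (n + 1) * A (m + 1) := by positivity
      have h3 : (A (n + 1) : ℝ) = weightSum Ω n := rfl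
      have h4 : (A (m + 1) : ℝ) = weightSum Ω m := rfl
      push_cast
      rw [h4] at h2
      rw [h3, h4]
      nlinarith
  -- comparing with `m = 1` costs the factor `A 2 / A 1`
  have hA2 : (1 : ℝ) ≤ A 2 / A 1 := by
    rw [one_le_div (by exact_mod_cast hA1)]
    exact_mod_cast hAmono (by norm_num : 1 ≤ 2)
  have hC3 : ∀ m n : ℕ, 1 ≤ m → m ≤ n →
      (A n : ℝ) * m ≤ ((C + 1) * (A 2 / A 1)) * n * A m := by
    intro m n hm hmn
    have hA1' : (0 : ℝ) < A 1 := by exact_mod_cast hA1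
    rcases hm.eq_or_lt with rfl | hm2
    · have e : ((C : ℝ) + 1) * (A 2 / A 1) * n * A 1 = (C + 1) * n * A 2 := by
        field_simp
      rw [e]
      rcases hmn.eq_or_lt with rfl | hn2
      · have h1 : (A 1 : ℝ) ≤ A 2 := by exact_mod_cast hAmono (by norm_num : 1 ≤ 2)
        have h2 : (0 : ℝ) ≤ C * A 2 := by positivity
        push_cast
        linarith
      · have h1 := hC2 2 n le_rfl hn2
        have h2 : (0 : ℝ) ≤ A n := by positivity
        push_cast at h1 ⊢
        linarith
    · refine (hC2 m n hm2 hmn).trans ?_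
      have h1 : (0 : ℝ) ≤ (C + 1) * n * A m := by positivity
      nlinarith
  have hD : (1 : ℝ) ≤ (C + 1) * (A 2 / A 1) := by
    have : (0 : ℝ) ≤ C := C.2
    nlinarith
  obtain ⟨w, hw, hw0, hwA⟩ := exists_antitone_weight (A := fun L => (A L : ℝ))
    (fun i j hij => by exact_mod_cast hAmono hij) (by exact_mod_cast hA1) hD hC3 (by simp [hA])
  let D : ℝ≥0 := (C + 1) * (A 2 / A 1)
  have hlow : ∀ f, injectionNorm w f ≤ (2 : ℝ≥0) * lorentzSeqNorm Ω 1 f := fun f => by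
    rw [lorentzSeqNorm_one]
    refine (injectionNorm_le hw f).trans (tsum_seqRearrangement_mul_le 2 (fun L => ?_) f)
    exact_mod_cast (hwA L).1
  have hup : ∀ f, lorentzSeqNorm Ω 1 f ≤ (2 * D : ℝ≥0) * injectionNorm w f := fun f => by
    rw [lorentzSeqNorm_one]
    refine (tsum_seqRearrangement_mul_le (w := w) D (fun L => ?_) f).trans ?_
    · exact_mod_cast (hwA L).2
    · refine (mul_le_mul_right (tsum_le_two_mul_injectionNorm hw0 f) (D : ℝ≥0∞)).trans_eq ?_
      push_cast
      ring
  refine LorentzSeqNormable.of_equivalent hΩ one_pos (injectionNorm w) (injectionNorm_add_le w)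
    (injectionNorm_smul w) (2 + 2 * D) (fun f => (hlow f).trans ?_) (fun f => (hup f).trans ?_)
  · gcongr
    exact le_self_add
  · gcongr
    exact le_add_self

/-- Averaging the indicator of `[0, m)` over the cyclic shifts of `[0, n)`. -/
theorem LorentzSeqNormable.exists_sum_rpow_le {Ω : ℕ → ℝ≥0} {p : ℝ} (hp : 0 < p)
    (h : LorentzSeqNormable Ω p) :
    ∃ K : ℝ≥0, ∀ m n : ℕ, m ≤ n →
      m * (∑ k ∈ Finset.range n, Ω k) ^ (1 / p) ≤
        K * n * (∑ k ∈ Finset.range m, Ω k) ^ (1 / p) := by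
  obtain ⟨K, hK⟩ := h.exists_averaging hp
  refine ⟨K, fun m n hmn => ?_⟩
  have h1 := hK n (fun k => if k < m then 1 else 0) (fun i j hij => by
    dsimp only
    split_ifs <;> first | omega | simp) fun k hk => by simp; omega
  have hf : (Finset.range n).filter (fun k => k < m) = Finset.range m := by
    ext k
    simp only [Finset.mem_filter, Finset.mem_range]
    omega
  have h2 : ∑ k ∈ Finset.range n, (if k < m then (1 : ℝ≥0) else 0) = m := by
    rw [← Finset.sum_filter, hf]
    simp
  have h3 : ∑ k ∈ Finset.range n, (if k < m then (1 : ℝ≥0) else 0) ^ p * Ω k =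
      ∑ k ∈ Finset.range m, Ω k := by
    rw [← hf, Finset.sum_filter]
    refine Finset.sum_congr rfl fun k _ => ?_
    split_ifs <;> simp [NNReal.zero_rpow hp.ne']
  rwa [h2, h3] at h1

theorem exists_weightSum_le_of_lorentzSeqNormable_one {Ω : ℕ → ℝ≥0}
    (h : LorentzSeqNormable Ω 1) :
    ∃ C : ℝ≥0, ∀ m n : ℕ, 0 < m → m < n →
      weightSum Ω n / ((n : ℝ≥0) + 1) ≤ C * (weightSum Ω m / ((m : ℝ≥0) + 1)) := by
  obtain ⟨K, hK⟩ := h.exists_sum_rpow_le one_pos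
  refine ⟨K, fun m n _ hmn => ?_⟩
  have h1 := hK (m + 1) (n + 1) (by omega)
  simp only [div_one, NNReal.rpow_one] at h1
  push_cast at h1
  rw [mul_div, div_le_div_iff₀ (by positivity) (by positivity)]
  unfold weightSum
  linarith

/-! ### Growth of the fundamental function -/

theorem sum_range_mul_eq {M : Type*} [AddCommMonoid M] (u : ℕ → M) (m q : ℕ) :
    ∑ k ∈ Finset.range (m * q), u k =
      ∑ L ∈ Finset.range q, ∑ i ∈ Finset.range m, u (m * L + i) := by
  induction q with
  | zero => simp
  | succ q ih => rw [Nat.mul_succ, Finset.sum_range_add, ih, Finset.sum_range_succ]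

/-- With `T N = ∑_{k ≤ N} 1 / φ k`, the dilation estimate gives `T (N / m) ≤ T N / 2`, so half of
`T N` is carried by the indices above `N / m`, where `φ` is comparable to `φ N`. -/
theorem sum_inv_le_of_dilation {φ : ℕ → ℝ} (hφ : Monotone φ) (h1 : 0 < φ 1) {m : ℕ} (hm : 1 ≤ m)
    (hD : ∀ L, 1 ≤ L → φ (m * L) ≤ m / 2 * φ L) {N : ℕ} (hN : 1 ≤ N) :
    ∑ k ∈ Finset.range N, 1 / φ (k + 1) ≤ m * (N / φ N) := by
  have hpos : ∀ k, 1 ≤ k → 0 < φ k := fun k hk => h1.trans_le (hφ hk)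
  have hm0 : (0 : ℝ) < m := by exact_mod_cast hm
  obtain ⟨q, hqN, hqN', hNq⟩ : ∃ q, m * q ≤ N ∧ q ≤ N ∧ N ≤ m * (q + 1) :=
    ⟨N / m, Nat.mul_div_le N m, Nat.div_le_self N m, (Nat.lt_mul_div_succ N hm).le⟩
  have ha : ∑ k ∈ Finset.range q, 1 / φ (k + 1) ≤
      1 / 2 * ∑ k ∈ Finset.range N, 1 / φ (k + 1) := by
    calc ∑ k ∈ Finset.range q, 1 / φ (k + 1)
        ≤ ∑ L ∈ Finset.range q, 1 / 2 * ∑ i ∈ Finset.range m, 1 / φ (m * L + i + 1) := by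
          refine Finset.sum_le_sum fun L _ => ?_
          have e1 : m * (1 / φ (m * (L + 1))) ≤
              ∑ i ∈ Finset.range m, 1 / φ (m * L + i + 1) := by
            have := Finset.card_nsmul_le_sum (Finset.range m)
              (fun i => 1 / φ (m * L + i + 1)) (1 / φ (m * (L + 1))) fun i hi => by
                refine one_div_le_one_div_of_le (hpos _ (by omega)) (hφ ?_)
                have := Finset.mem_range.1 hi
                rw [Nat.mul_succ]
                omega
            rwa [Finset.card_range, nsmul_eq_mul] at this
          have e2 := hD (L + 1) (by omega)
          have p1 := hpos (L + 1) (by omega)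
          have p2 := hpos (m * (L + 1)) (Nat.mul_pos hm (by omega))
          have e3 : 1 / φ (L + 1) ≤ 1 / 2 * (m * (1 / φ (m * (L + 1)))) := by
            rw [show 1 / 2 * (m * (1 / φ (m * (L + 1)))) = (m / 2) / φ (m * (L + 1)) by ring,
              div_le_div_iff₀ p1 p2, one_mul]
            exact e2
          linarith
      _ = 1 / 2 * ∑ k ∈ Finset.range (m * q), 1 / φ (k + 1) := by
          rw [sum_range_mul_eq, Finset.mul_sum]
      _ ≤ _ := by
          gcongr ?_ * ?_
          refine Finset.sum_le_sum_of_subset_of_nonneg (Finset.range_mono hqN) fun k _ _ => ?_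
          exact (one_div_pos.2 (hpos _ (by omega))).le
  have pq := hpos (q + 1) (by omega)
  have hb : ∑ k ∈ Finset.Ico q N, 1 / φ (k + 1) ≤ N * (1 / φ (q + 1)) := by
    have e1 : ∑ k ∈ Finset.Ico q N, 1 / φ (k + 1) ≤ (Finset.Ico q N).card • (1 / φ (q + 1)) := by
      refine Finset.sum_le_card_nsmul _ _ _ fun k hk => ?_
      refine one_div_le_one_div_of_le pq (hφ ?_)
      have := (Finset.mem_Ico.1 hk).1
      omega
    refine e1.trans ?_
    rw [nsmul_eq_mul, Nat.card_Ico]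
    gcongr
    exact Nat.sub_le N q
  have hc : φ N ≤ m / 2 * φ (q + 1) := (hφ hNq).trans (hD _ (by omega))
  have hd : 1 / φ (q + 1) ≤ m / 2 * (1 / φ N) := by
    rw [mul_one_div, div_le_div_iff₀ pq (hpos N hN), one_mul]
    exact hc
  have hsplit := Finset.sum_range_add_sum_Ico (fun k => 1 / φ (k + 1)) hqN'
  have he : (N : ℝ) * (1 / φ (q + 1)) ≤ N * (m / 2 * (1 / φ N)) := by gcongr
  have : (m : ℝ) * (N / φ N) = 2 * (N * (m / 2 * (1 / φ N))) := by ring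
  linarith

/-- Conversely each dyadic block `(2 ^ i L, 2 ^ (i + 1) L]` contributes a fixed multiple of
`L / φ L` to `T (2 ^ I L)`, so that the dilation constants `2 ^ I` can be improved by any
factor. -/
theorem exists_dilation_of_sum_inv_le {φ : ℕ → ℝ} (hφ : Monotone φ) (h1 : 0 < φ 1) {C : ℝ}
    (hC : ∀ N : ℕ, 1 ≤ N → ∑ k ∈ Finset.range N, 1 / φ (k + 1) ≤ C * (N / φ N)) :
    ∃ m : ℕ, 1 ≤ m ∧ ∀ L, 1 ≤ L → φ (m * L) ≤ m / 4 * φ L := by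
  have hpos : ∀ k, 1 ≤ k → 0 < φ k := fun k hk => h1.trans_le (hφ hk)
  set T : ℕ → ℝ := fun N => ∑ k ∈ Finset.range N, 1 / φ (k + 1) with hT
  have hblock : ∀ a b, a ≤ b → 1 ≤ b → T a + (b - a) * (1 / φ b) ≤ T b := by
    intro a b hab hb
    simp only [hT]
    rw [← Finset.sum_range_add_sum_Ico (fun k => 1 / φ (k + 1)) hab]
    gcongr
    have e1 : (Finset.Ico a b).card • (1 / φ b) ≤ ∑ k ∈ Finset.Ico a b, 1 / φ (k + 1) := by
      refine Finset.card_nsmul_le_sum _ _ _ fun k hk => ?_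
      have := (Finset.mem_Ico.1 hk).2
      exact one_div_le_one_div_of_le (hpos _ (by omega)) (hφ (by omega))
    rwa [nsmul_eq_mul, Nat.card_Ico, Nat.cast_sub hab] at e1
  have hTlow : ∀ L, 1 ≤ L → L / φ L ≤ T L := fun L hL => by
    have := hblock 0 L (Nat.zero_le _) hL
    simp only [hT, Finset.range_zero, Finset.sum_empty, Nat.cast_zero] at this ⊢
    rw [div_eq_mul_one_div]
    linarith
  have hC1 : 1 ≤ C := by
    have e1 := hTlow 1 le_rfl
    have e2 := hC 1 le_rfl
    have e3 : 0 < ((1 : ℕ) : ℝ) / φ 1 := by simpa using h1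
    by_contra! hlt
    have := mul_lt_mul_of_pos_right hlt e3
    have e4 : T 1 ≤ C * ((1 : ℕ) / φ 1) := e2
    linarith
  have hC0 : 0 < C := by linarith
  have hI : ∀ L, 1 ≤ L → ∀ I : ℕ, (I : ℝ) / (2 * C) * (L / φ L) ≤ T (2 ^ I * L) := by
    intro L hL I
    induction I with
    | zero =>
      have := hTlow L hL
      have h2 := hpos L hL
      have : 0 ≤ (L : ℝ) / φ L := by positivity
      simp only [Nat.cast_zero, zero_div, zero_mul, pow_zero, one_mul]
      linarith
    | succ I ih =>
      set n := 2 ^ I * L with hn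
      have hn1 : 1 ≤ n := Nat.mul_pos (by positivity) hL
      have h2n : 2 ^ (I + 1) * L = 2 * n := by rw [hn]; ring
      have hLn : L ≤ 2 * n := by
        have : 1 * L ≤ 2 ^ I * L := Nat.mul_le_mul_right L Nat.one_le_two_pow
        omega
      rw [h2n]
      have e1 := hblock n (2 * n) (by omega) (by omega)
      have e2 := hC (2 * n) (by omega)
      have e3 := hTlow L hL
      have e4 : T L ≤ T (2 * n) := by
        have := hblock L (2 * n) hLn (by omega)
        have p := hpos (2 * n) (by omega)
        have : (0 : ℝ) ≤ ((2 * n : ℕ) - L) * (1 / φ (2 * n)) := by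
          have : (L : ℝ) ≤ (2 * n : ℕ) := by exact_mod_cast hLn
          have : (0 : ℝ) ≤ (2 * n : ℕ) - L := by linarith
          positivity
        linarith
      have e5 : 1 / (2 * C) * (L / φ L) ≤ ((2 * n : ℕ) - n) * (1 / φ (2 * n)) := by
        have e6 : (L : ℝ) / φ L ≤ C * ((2 * n : ℕ) / φ (2 * n)) := by
          have : T (2 * n) ≤ C * ((2 * n : ℕ) / φ (2 * n)) := e2
          linarith
        calc 1 / (2 * C) * (L / φ L) ≤ 1 / (2 * C) * (C * ((2 * n : ℕ) / φ (2 * n))) := by gcongr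
          _ = _ := by
            push_cast
            field_simp
            ring
      push_cast at e1 e5 ⊢
      have e7 : ((I : ℝ) + 1) / (2 * C) * (L / φ L) =
          I / (2 * C) * (L / φ L) + 1 / (2 * C) * (L / φ L) := by ring
      linarith
  obtain ⟨I, hIC⟩ := exists_nat_ge (8 * C ^ 2)
  refine ⟨2 ^ I, Nat.one_le_two_pow, fun L hL => ?_⟩
  have hn1 : 1 ≤ 2 ^ I * L := Nat.mul_pos (by positivity) hL
  have e1 := (hI L hL I).trans (hC _ hn1)
  have p1 := hpos L hL
  have p2 := hpos _ hn1
  have hL0 : (0 : ℝ) < L := by exact_mod_cast hL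
  rw [div_mul_div_comm, ← mul_div_assoc, div_le_div_iff₀ (by positivity) p2] at e1
  push_cast at e1 ⊢
  have e2 : (I : ℝ) * φ (2 ^ I * L) ≤ 2 * C ^ 2 * 2 ^ I * φ L := by
    refine le_of_mul_le_mul_right ?_ hL0
    linarith
  have e3 : 8 * C ^ 2 * φ (2 ^ I * L) ≤ I * φ (2 ^ I * L) := by gcongr
  have e4 : 0 < C ^ 2 := by positivity
  have e5 : C ^ 2 * (4 * φ (2 ^ I * L)) ≤ C ^ 2 * (2 ^ I * φ L) := by linarith
  have e6 := le_of_mul_le_mul_left e5 e4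
  linarith

/-! ### Necessity for exponents above one -/

/-- The test sequence `∑_{i ≤ I} 2 ^ (-i) 1_[0, 2 ^ i L)` is a truncation of `k ↦ L / k`. Its
functional is of the order of `(I + 1) ^ (1 / p) φ L`, its mean over `[0, 2 ^ I L)` is
`(I + 1) 2 ^ (-I)`, and for `p > 1` the latter wins. -/
theorem LorentzSeqNormable.exists_dilation {Ω : ℕ → ℝ≥0} {p : ℝ} (hp : 1 < p)
    (h : LorentzSeqNormable Ω p) :
    ∃ m : ℕ, 1 ≤ m ∧ ∀ L, 1 ≤ L →
      ((∑ k ∈ Finset.range (m * L), Ω k : ℝ≥0) : ℝ) ^ (1 / p) ≤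
        m / 2 * ((∑ k ∈ Finset.range L, Ω k : ℝ≥0) : ℝ) ^ (1 / p) := by
  have hp0 : 0 < p := by linarith
  obtain ⟨K, hK⟩ := h.exists_averaging hp0
  obtain ⟨K', hK'⟩ := h.exists_sum_rpow_le hp0
  set A : ℕ → ℝ≥0 := fun L => ∑ k ∈ Finset.range L, Ω k with hA
  have hAmul : ∀ (i L : ℕ), 1 ≤ L → A (2 ^ i * L) ≤ (K' * 2 ^ i) ^ p * A L := by
    intro i L hL
    have h1 := hK' L (2 ^ i * L) (Nat.le_mul_of_pos_left L (by positivity))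
    have hL0 : (0 : ℝ≥0) < L := by exact_mod_cast hL
    have h2 : A (2 ^ i * L) ^ (1 / p) ≤ (K' * 2 ^ i) * A L ^ (1 / p) := by
      refine le_of_mul_le_mul_left (h1.trans_eq ?_) hL0
      push_cast
      ring
    have h3 := NNReal.rpow_le_rpow h2 hp0.le
    rwa [NNReal.mul_rpow, ← NNReal.rpow_mul, ← NNReal.rpow_mul, one_div_mul_cancel hp0.ne',
      NNReal.rpow_one, NNReal.rpow_one] at h3
  let χ : ℕ → ℕ → ℕ → ℝ≥0 := fun L i k => if k < 2 ^ i * L then 1 else 0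
  let g : ℕ → ℕ → ℕ → ℝ≥0 := fun I L k =>
    ∑ i ∈ Finset.range (I + 1), (1 / 2) ^ i * χ L i k
  have hgeom : ∀ I j : ℕ, ∑ i ∈ Finset.Ico j (I + 1), (1 / 2 : ℝ≥0) ^ i ≤ 2 * (1 / 2) ^ j := by
    intro I j
    rw [← NNReal.coe_le_coe]
    push_cast
    refine (geom_sum_Ico_le_of_lt_one (by norm_num) (by norm_num)).trans_eq ?_
    ring
  -- only the scales `2 ^ i L > k` contribute at `k`, so the first of them dominates
  have hgp : ∀ I L k, g I L k ^ p ≤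
      ∑ i ∈ Finset.range (I + 1), (2 * (1 / 2) ^ i) ^ p * χ L i k := by
    intro I L k
    by_cases hex : ∃ i, k < 2 ^ i * L ∧ i ≤ I
    · classical
      let j := Nat.find hex
      have hj : k < 2 ^ j * L ∧ j ≤ I := Nat.find_spec hex
      have hjmin : ∀ i < j, χ L i k = 0 := fun i hi => by
        have := Nat.find_min hex hi
        have hi' : i ≤ I := by omega
        simp only [χ]
        rw [if_neg fun hk => this ⟨hk, hi'⟩]
      have h1 : g I L k ≤ 2 * (1 / 2) ^ j := by
        refine le_trans ?_ (hgeom I j)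
        simp only [g]
        rw [← Finset.sum_range_add_sum_Ico _ (show j ≤ I + 1 by omega),
          Finset.sum_eq_zero fun i hi => by rw [hjmin i (Finset.mem_range.1 hi), mul_zero],
          zero_add]
        refine Finset.sum_le_sum fun i _ => ?_
        simp only [χ]
        split_ifs <;> simp
      calc g I L k ^ p ≤ (2 * (1 / 2) ^ j) ^ p * χ L j k := by
            simp only [χ, if_pos hj.1, mul_one]
            gcongr
        _ ≤ _ := Finset.single_le_sum (f := fun i => (2 * (1 / 2 : ℝ≥0) ^ i) ^ p * χ L i k)
            (fun _ _ => zero_le) (Finset.mem_range.2 (by omega))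
    · push Not at hex
      have : g I L k = 0 := Finset.sum_eq_zero fun i hi => by
        have hi' := Finset.mem_range.1 hi
        have : ¬ k < 2 ^ i * L := fun hk => absurd (hex i hk) (by omega)
        simp [χ, this]
      rw [this, NNReal.zero_rpow hp0.ne']
      exact zero_le
  have hχsum : ∀ I L i, i ≤ I → ∀ v : ℕ → ℝ≥0,
      ∑ k ∈ Finset.range (2 ^ I * L), χ L i k * v k = ∑ k ∈ Finset.range (2 ^ i * L), v k := by
    intro I L i hi v
    have hle : 2 ^ i * L ≤ 2 ^ I * L :=
      Nat.mul_le_mul_right L (Nat.pow_le_pow_right (by norm_num) hi)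
    have hf : (Finset.range (2 ^ I * L)).filter (fun k => k < 2 ^ i * L) =
        Finset.range (2 ^ i * L) := by
      ext k
      simp only [Finset.mem_filter, Finset.mem_range]
      omega
    rw [← hf, Finset.sum_filter]
    refine Finset.sum_congr rfl fun k _ => ?_
    simp only [χ]
    split_ifs <;> simp
  have hgsum : ∀ I L, ∑ k ∈ Finset.range (2 ^ I * L), g I L k = (I + 1) * L := by
    intro I L
    simp only [g]
    rw [Finset.sum_comm]
    have : ∀ i ∈ Finset.range (I + 1),
        ∑ k ∈ Finset.range (2 ^ I * L), (1 / 2 : ℝ≥0) ^ i * χ L i k = L := fun i hi => by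
      have h1 := hχsum I L i (by have := Finset.mem_range.1 hi; omega) fun _ => 1
      simp only [mul_one, Finset.sum_const, Finset.card_range, nsmul_eq_mul] at h1
      rw [← Finset.mul_sum, h1]
      push_cast
      rw [← mul_assoc, ← mul_pow]
      norm_num
    rw [Finset.sum_congr rfl this]
    simp
  have hgΩ : ∀ I L, 1 ≤ L → ∑ k ∈ Finset.range (2 ^ I * L), g I L k ^ p * Ω k ≤
      (I + 1) * ((2 * K') ^ p * A L) := by
    intro I L hL
    calc ∑ k ∈ Finset.range (2 ^ I * L), g I L k ^ p * Ω k
        ≤ ∑ k ∈ Finset.range (2 ^ I * L), ∑ i ∈ Finset.range (I + 1),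
            (2 * (1 / 2) ^ i) ^ p * (χ L i k * Ω k) := by
          refine Finset.sum_le_sum fun k _ => ?_
          refine (mul_le_mul_left (hgp I L k) (Ω k)).trans_eq ?_
          rw [Finset.sum_mul]
          exact Finset.sum_congr rfl fun i _ => mul_assoc _ _ _
      _ = ∑ i ∈ Finset.range (I + 1), (2 * (1 / 2) ^ i) ^ p * A (2 ^ i * L) := by
          rw [Finset.sum_comm]
          refine Finset.sum_congr rfl fun i hi => ?_
          rw [← Finset.mul_sum, hχsum I L i (by have := Finset.mem_range.1 hi; omega)]
      _ ≤ ∑ i ∈ Finset.range (I + 1), (2 * K') ^ p * A L := by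
          refine Finset.sum_le_sum fun i _ => ?_
          refine (mul_le_mul_right (hAmul i L hL) _).trans_eq ?_
          rw [← mul_assoc, ← NNReal.mul_rpow]
          congr 2
          have : (1 / 2 : ℝ≥0) ^ i * 2 ^ i = 1 := by rw [← mul_pow]; norm_num
          calc 2 * (1 / 2 : ℝ≥0) ^ i * (K' * 2 ^ i) = 2 * K' * ((1 / 2) ^ i * 2 ^ i) := by ring
            _ = 2 * K' := by rw [this, mul_one]
      _ = _ := by simp
  have hmain : ∀ I L : ℕ, 1 ≤ L → ((I : ℝ) + 1) ^ (1 - 1 / p) * (A (2 ^ I * L) : ℝ) ^ (1 / p) ≤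
      2 * K * K' * (2 ^ I * (A L : ℝ) ^ (1 / p)) := by
    intro I L hL
    have h1 := hK (2 ^ I * L) (g I L) (fun a b hab => by
      refine Finset.sum_le_sum fun i _ => ?_
      gcongr
      simp only [χ]
      split_ifs <;> first | omega | simp) (fun k hk => by
        refine Finset.sum_eq_zero fun i hi => ?_
        have hle : 2 ^ i * L ≤ 2 ^ I * L := Nat.mul_le_mul_right L
          (Nat.pow_le_pow_right (by norm_num) (by have := Finset.mem_range.1 hi; omega))
        have : ¬ k < 2 ^ i * L := by omega
        simp [χ, this])
    rw [hgsum] at h1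
    have h2 := h1.trans (mul_le_mul_right (NNReal.rpow_le_rpow (hgΩ I L hL)
      (show 0 ≤ 1 / p by positivity)) _)
    rw [NNReal.mul_rpow, NNReal.mul_rpow, ← NNReal.rpow_mul, mul_one_div_cancel hp0.ne',
      NNReal.rpow_one, ← NNReal.coe_le_coe] at h2
    push_cast at h2
    have hL0 : (0 : ℝ) < L := by exact_mod_cast hL
    have hI0 : (0 : ℝ) < (I : ℝ) + 1 := by positivity
    have hI1 : (0 : ℝ) < ((I : ℝ) + 1) ^ (1 / p) := by positivity
    have hI2 : ((I : ℝ) + 1) = ((I : ℝ) + 1) ^ (1 - 1 / p) * ((I : ℝ) + 1) ^ (1 / p) := by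
      rw [← Real.rpow_add hI0]
      simp
    refine le_of_mul_le_mul_right ?_ (mul_pos hL0 hI1)
    have h3 : ((I : ℝ) + 1) ^ (1 - 1 / p) * ((A (2 ^ I * L) : ℝ≥0) : ℝ) ^ (1 / p) *
        (L * ((I : ℝ) + 1) ^ (1 / p)) =
        (I + 1) * L * ((A (2 ^ I * L) : ℝ≥0) : ℝ) ^ (1 / p) := by
      conv_rhs => rw [hI2]
      ring
    have h4 : ((A (2 ^ I * L) : ℝ≥0) : ℝ) = ∑ i ∈ Finset.range (2 ^ I * L), (Ω i : ℝ) := by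
      simp [hA]
    rw [h3, h4]
    refine h2.trans_eq ?_
    ring
  have hpp : 0 < 1 - 1 / p := by
    rw [sub_pos, div_lt_one hp0]
    exact hp
  have hlim := (tendsto_rpow_atTop hpp).comp
    ((Filter.tendsto_atTop_add_const_right _ (1 : ℝ) (tendsto_natCast_atTop_atTop (R := ℝ))))
  obtain ⟨I, hI⟩ := (hlim.eventually_ge_atTop (2 * (2 * (K : ℝ) * K') + 1)).exists
  simp only [Function.comp] at hI
  refine ⟨2 ^ I, Nat.one_le_two_pow, fun L hL => ?_⟩
  have h1 := hmain I L hL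
  set x : ℝ := ((A (2 ^ I * L) : ℝ≥0) : ℝ) ^ (1 / p) with hx
  set y : ℝ := 2 ^ I * ((A L : ℝ≥0) : ℝ) ^ (1 / p) with hy
  have hx0 : 0 ≤ x := by positivity
  have hy0 : 0 ≤ y := by positivity
  set B : ℝ := 2 * (K : ℝ) * K' with hB
  have hB0 : 0 ≤ B := by positivity
  have h2 : (2 * B + 1) * x ≤ B * y := (mul_le_mul_of_nonneg_right hI hx0).trans h1
  have h3 : x ≤ y / 2 := by
    by_contra! hlt
    have := mul_le_mul_of_nonneg_left hlt.le hB0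
    nlinarith
  have h4 : (((2 ^ I : ℕ) : ℝ)) / 2 * ((A L : ℝ≥0) : ℝ) ^ (1 / p) = y / 2 := by
    rw [hy]
    push_cast
    ring
  rw [h4]
  exact h3

/-! ### Sufficiency for exponents above one -/

/-- Dilation by `m` has norm at most the dilation constant of the weight on nonincreasing
sequences, since those are mixtures of indicators of initial segments. -/
theorem sum_div_mul_le_of_dilation {Ω : ℕ → ℝ≥0} {m : ℕ} (hm : 1 ≤ m) {D : ℝ≥0}
    (hD : ∀ L, ∑ k ∈ Finset.range (m * L), Ω k ≤ D * ∑ k ∈ Finset.range L, Ω k)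
    {h : ℕ → ℝ≥0∞} (hh : Antitone h) (J : ℕ) :
    ∑ j ∈ Finset.range J, h (j / m) * Ω j ≤ D * ∑ q ∈ Finset.range J, h q * Ω q := by
  have hmaps : ∀ j ∈ Finset.range J, j / m ∈ Finset.range J := fun j hj =>
    Finset.mem_range.2 ((Nat.div_le_self j m).trans_lt (Finset.mem_range.1 hj))
  have key := sum_mul_le_sum_mul_of_antitone J
    (a := fun q => ∑ j ∈ (Finset.range J).filter (fun j => j / m = q), (Ω j : ℝ≥0∞))
    (b := fun q => (D : ℝ≥0∞) * Ω q) hh (fun L hL => by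
      have h1 : ∑ q ∈ Finset.range L,
          ∑ j ∈ (Finset.range J).filter (fun j => j / m = q), (Ω j : ℝ≥0∞) ≤
          ∑ j ∈ Finset.range (m * L), (Ω j : ℝ≥0∞) := by
        rw [Finset.sum_fiberwise_eq_sum_filter]
        refine Finset.sum_le_sum_of_subset fun j hj => ?_
        simp only [Finset.mem_filter, Finset.mem_range] at hj ⊢
        rw [mul_comm]
        exact (Nat.div_lt_iff_lt_mul hm).1 hj.2
      refine h1.trans ?_
      rw [← Finset.mul_sum]
      exact_mod_cast hD L)
  rw [← Finset.sum_fiberwise_of_maps_to hmaps, Finset.mul_sum]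
  refine le_trans (le_of_eq ?_) (key.trans (le_of_eq ?_))
  · refine Finset.sum_congr rfl fun q _ => ?_
    rw [Finset.sum_mul]
    refine Finset.sum_congr rfl fun j hj => ?_
    rw [(Finset.mem_filter.1 hj).2, mul_comm]
  · exact Finset.sum_congr rfl fun q _ => by ring

/-- The means `(h 0 + ⋯ + h n) / (n + 1)`. -/
noncomputable def seqAverage (h : ℕ → ℝ≥0∞) (n : ℕ) : ℝ≥0∞ :=
  (∑ k ∈ Finset.range (n + 1), h k) / (n + 1)

theorem seqAverage_le {h : ℕ → ℝ≥0∞} (hh : Antitone h) (n : ℕ) : seqAverage h n ≤ h 0 := by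
  refine ENNReal.div_le_of_le_mul' ?_
  refine (Finset.sum_le_card_nsmul _ _ (h 0) fun k _ => hh (Nat.zero_le k)).trans_eq ?_
  simp [nsmul_eq_mul]

theorem seqAverage_antitone {h : ℕ → ℝ≥0∞} (hh : Antitone h) : Antitone (seqAverage h) := by
  refine antitone_nat_of_succ_le fun n => ?_
  have hn : ((n : ℝ≥0∞) + 1) ≠ 0 := by simp
  have hn' : ((n : ℝ≥0∞) + 1) ≠ ∞ := by simp
  have h1 : h (n + 1) ≤ seqAverage h n := by
    unfold seqAverage
    rw [ENNReal.le_div_iff_mul_le (Or.inl hn) (Or.inl hn')]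
    refine le_trans (le_of_eq ?_) (Finset.card_nsmul_le_sum _ _ (h (n + 1)) fun k hk =>
      hh (Finset.mem_range.1 hk).le)
    rw [Finset.card_range, nsmul_eq_mul, mul_comm]
    push_cast
    rfl
  have h2 : ∑ k ∈ Finset.range (n + 1), h k = (n + 1) * seqAverage h n := by
    unfold seqAverage
    rw [ENNReal.mul_div_cancel hn hn']
  refine ENNReal.div_le_of_le_mul' ?_
  rw [Finset.sum_range_succ, h2]
  push_cast
  calc (n + 1) * seqAverage h n + h (n + 1) ≤ (n + 1) * seqAverage h n + seqAverage h n := by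
        gcongr
    _ = (n + 1 + 1) * seqAverage h n := by ring

/-- The first `j / m` terms have weight at most `2 / m` relative to their own mean, and the
remaining ones are at most `h (j / m)`. -/
theorem seqAverage_le_dilation {h : ℕ → ℝ≥0∞} (hh : Antitone h) {m : ℕ} (hm : 1 ≤ m) (j : ℕ) :
    seqAverage h j ≤ (2 / m : ℝ≥0) * seqAverage h (j / m) + h (j / m) := by
  obtain ⟨q, hq, hq1, hq2⟩ : ∃ q, q = j / m ∧ m * q ≤ j ∧ q ≤ j :=
    ⟨j / m, rfl, Nat.mul_div_le j m, Nat.div_le_self j m⟩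
  rw [← hq]
  refine ENNReal.div_le_of_le_mul' ?_
  rw [← Finset.sum_range_add_sum_Ico h (show q ≤ j + 1 by omega), mul_add]
  have hm0 : (m : ℝ≥0) ≠ 0 := by exact_mod_cast (by omega : m ≠ 0)
  refine add_le_add ?_ ?_
  · rcases Nat.eq_zero_or_pos q with rfl | hqpos
    · simp
    · have h1 : ∑ k ∈ Finset.range q, h k ≤ (q + 1) * seqAverage h q := by
        unfold seqAverage
        rw [ENNReal.mul_div_cancel (by simp) (by simp)]
        exact Finset.sum_le_sum_of_subset (Finset.range_mono (Nat.le_succ q))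
      refine h1.trans ?_
      rw [← mul_assoc]
      gcongr
      have h2 : (q : ℝ≥0) + 1 ≤ (j + 1) * (2 / m) := by
        rw [mul_div, le_div_iff₀ (pos_iff_ne_zero.2 hm0)]
        have h3 : (q + 1) * m ≤ (j + 1) * 2 := by nlinarith
        exact_mod_cast h3
      exact_mod_cast h2
  · refine (Finset.sum_le_card_nsmul _ _ (h q) fun k hk => hh (Finset.mem_Ico.1 hk).1).trans ?_
    rw [nsmul_eq_mul, Nat.card_Ico]
    gcongr
    exact_mod_cast Nat.sub_le (j + 1) q

/-- Hardy's inequality for nonincreasing sequences. Dilation by `m` has norm at most `m / 4`, so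
by `seqAverage_le_dilation` the means `H` satisfy `‖H‖ ≤ ‖H‖ / 2 + (m / 4) ‖h‖`; on finite sums
the first term on the right can be absorbed. -/
theorem hardy_inequality {Ω : ℕ → ℝ≥0} (hΩ : Ω 0 ≠ 0) {p : ℝ} (hp : 1 ≤ p) {m : ℕ} (hm : 1 ≤ m)
    (hD : ∀ L, ∑ k ∈ Finset.range (m * L), Ω k ≤
      (m / 4 : ℝ≥0) ^ p * ∑ k ∈ Finset.range L, Ω k)
    {h : ℕ → ℝ≥0∞} (hh : Antitone h) :
    (∑' n, seqAverage h n ^ p * (Ω n : ℝ≥0∞)) ^ (1 / p) ≤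
      (m : ℝ≥0) * (∑' n, h n ^ p * (Ω n : ℝ≥0∞)) ^ (1 / p) := by
  have hp0 : 0 < p := by linarith
  have hip : 0 ≤ 1 / p := by positivity
  have hm0 : (m : ℝ≥0) ≠ 0 := by exact_mod_cast (by omega : m ≠ 0)
  by_cases htop : h 0 = ∞
  · have : ∑' n, h n ^ p * (Ω n : ℝ≥0∞) = ∞ := by
      refine top_le_iff.1 (le_trans ?_ (ENNReal.le_tsum 0))
      rw [htop, ENNReal.top_rpow_of_pos hp0, ENNReal.top_mul (by exact_mod_cast hΩ)]
    rw [this, ENNReal.top_rpow_of_pos (by positivity), ENNReal.mul_top (by exact_mod_cast hm0)]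
    exact le_top
  let X : (ℕ → ℝ≥0∞) → ℕ → ℝ≥0∞ := fun u J =>
    (∑ j ∈ Finset.range J, u j ^ p * (Ω j : ℝ≥0∞)) ^ (1 / p)
  have hrew : ∀ u J, X u J =
      (∑ j ∈ Finset.range J, (u j * (Ω j : ℝ≥0∞) ^ (1 / p)) ^ p) ^ (1 / p) := fun u J => by
    simp only [X]
    congr 1
    refine Finset.sum_congr rfl fun j _ => ?_
    rw [ENNReal.mul_rpow_of_nonneg _ _ hp0.le, ← ENNReal.rpow_mul, one_div_mul_cancel hp0.ne',
      ENNReal.rpow_one]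
  have hadd : ∀ u v J, X (fun j => u j + v j) J ≤ X u J + X v J := fun u v J => by
    rw [hrew, hrew, hrew]
    simp only [add_mul]
    exact ENNReal.Lp_add_le _ _ _ hp
  have hcmul : ∀ (c : ℝ≥0∞) u J, X (fun j => c * u j) J = c * X u J := fun c u J => by
    simp only [X]
    simp only [ENNReal.mul_rpow_of_nonneg _ _ hp0.le, mul_assoc, ← Finset.mul_sum]
    rw [ENNReal.mul_rpow_of_nonneg _ _ hip, ← ENNReal.rpow_mul, mul_one_div_cancel hp0.ne',
      ENNReal.rpow_one]
  have hdil : ∀ u : ℕ → ℝ≥0∞, Antitone u → ∀ J,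
      X (fun j => u (j / m)) J ≤ (m / 4 : ℝ≥0) * X u J := fun u hu J => by
    have h1 := sum_div_mul_le_of_dilation hm hD
      (h := fun n => u n ^ p) (fun i j hij => ENNReal.rpow_le_rpow (hu hij) hp0.le) J
    refine (ENNReal.rpow_le_rpow h1 hip).trans_eq ?_
    rw [ENNReal.mul_rpow_of_nonneg _ _ hip, ENNReal.coe_rpow_of_nonneg _ hp0.le,
      ← ENNReal.rpow_mul, mul_one_div_cancel hp0.ne', ENNReal.rpow_one]
  have hfin : ∀ J, X (seqAverage h) J ≠ ∞ := fun J => by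
    refine ENNReal.rpow_ne_top_of_nonneg hip (ENNReal.sum_ne_top.2 fun j _ => ?_)
    exact ENNReal.mul_ne_top (ENNReal.rpow_ne_top_of_nonneg hp0.le
      (ne_top_of_le_ne_top htop (seqAverage_le hh j))) ENNReal.coe_ne_top
  have hhalf : ((2 / m : ℝ≥0) : ℝ≥0∞) * (m / 4 : ℝ≥0) = (1 / 2 : ℝ≥0) := by
    rw [← ENNReal.coe_mul]
    congr 1
    field_simp
    norm_num
  have hJ : ∀ J, X (seqAverage h) J ≤ (m : ℝ≥0) * X h J := fun J => by
    have h1 : X (seqAverage h) J ≤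
        (1 / 2 : ℝ≥0) * X (seqAverage h) J + (m / 4 : ℝ≥0) * X h J := by
      calc X (seqAverage h) J
          ≤ X (fun j => (2 / m : ℝ≥0) * seqAverage h (j / m) + h (j / m)) J := by
            simp only [X]
            gcongr with j _
            exact seqAverage_le_dilation hh hm j
        _ ≤ X (fun j => (2 / m : ℝ≥0) * seqAverage h (j / m)) J + X (fun j => h (j / m)) J :=
            hadd _ _ J
        _ ≤ (2 / m : ℝ≥0) * ((m / 4 : ℝ≥0) * X (seqAverage h) J) + (m / 4 : ℝ≥0) * X h J := by
            rw [hcmul]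
            gcongr
            · exact hdil _ (seqAverage_antitone hh) J
            · exact hdil _ hh J
        _ = _ := by rw [← mul_assoc, hhalf]
    by_cases hX : X h J = ∞
    · rw [hX, ENNReal.mul_top (by exact_mod_cast hm0)]
      exact le_top
    · have ha := hfin J
      generalize X (seqAverage h) J = a at h1 ha ⊢
      generalize X h J = y at h1 hX ⊢
      lift a to ℝ≥0 using ha
      lift y to ℝ≥0 using hX
      have h2 : a ≤ 1 / 2 * a + m / 4 * y := by exact_mod_cast h1
      have h3 : a ≤ m * y := by
        rw [← NNReal.coe_le_coe] at h2 ⊢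
        push_cast at h2 ⊢
        have : (0 : ℝ) ≤ m * y := by positivity
        linarith
      exact_mod_cast h3
  rw [ENNReal.tsum_eq_iSup_nat]
  have hcont : ∀ J, X (seqAverage h) J ≤
      (m : ℝ≥0) * (∑' n, h n ^ p * (Ω n : ℝ≥0∞)) ^ (1 / p) := fun J => by
    refine (hJ J).trans ?_
    gcongr
    exact ENNReal.rpow_le_rpow (ENNReal.sum_le_tsum _) hip
  have h2 : ∀ J, ∑ j ∈ Finset.range J, seqAverage h j ^ p * (Ω j : ℝ≥0∞) ≤
      ((m : ℝ≥0) * (∑' n, h n ^ p * (Ω n : ℝ≥0∞)) ^ (1 / p)) ^ p := fun J => by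
    have := ENNReal.rpow_le_rpow (hcont J) hp0.le
    rwa [← ENNReal.rpow_mul, one_div_mul_cancel hp0.ne', ENNReal.rpow_one] at this
  refine (ENNReal.rpow_le_rpow (iSup_le h2) hip).trans_eq ?_
  rw [← ENNReal.rpow_mul, mul_one_div_cancel hp0.ne', ENNReal.rpow_one]

/-- The largest sum of `|f|` over at most `n` indices. -/
noncomputable def topSum (f : ℕ → ℂ) (n : ℕ) : ℝ≥0∞ :=
  ⨆ (A : Finset ℕ) (_ : A.card ≤ n), ∑ k ∈ A, (‖f k‖₊ : ℝ≥0∞)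

theorem topSum_add_le (f g : ℕ → ℂ) (n : ℕ) : topSum (f + g) n ≤ topSum f n + topSum g n := by
  refine iSup₂_le fun A hA => ?_
  refine le_trans ?_ (add_le_add (le_iSup₂_of_le A hA le_rfl) (le_iSup₂_of_le A hA le_rfl))
  rw [← Finset.sum_add_distrib]
  exact Finset.sum_le_sum fun k _ => by exact_mod_cast nnnorm_add_le (f k) (g k)

theorem topSum_smul (c : ℂ) (f : ℕ → ℂ) (n : ℕ) : topSum (c • f) n = ‖c‖₊ * topSum f n := by
  simp only [topSum, ENNReal.mul_iSup, Finset.mul_sum, Pi.smul_apply, nnnorm_smul,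
    ENNReal.coe_mul]

theorem topSum_div_le_seqAverage (f : ℕ → ℂ) (n : ℕ) :
    topSum f (n + 1) / (n + 1) ≤ seqAverage (seqRearrangement f) n :=
  ENNReal.div_le_div_right (iSup₂_le fun A hA => sum_le_sum_seqRearrangement f (n + 1) A hA) _

theorem seqRearrangement_le_topSum_div (f : ℕ → ℂ) (n : ℕ) :
    seqRearrangement f n ≤ topSum f (n + 1) / (n + 1) := by
  refine le_of_forall_lt fun t ht => ?_
  obtain ⟨u, hu, hu'⟩ := exists_between ht
  obtain ⟨A, hA, hAt⟩ := exists_finset_of_lt_seqRearrangement f hu'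
  refine hu.trans_le ?_
  rw [ENNReal.le_div_iff_mul_le (by simp) (by simp)]
  refine le_trans ?_ (le_iSup₂_of_le A hA.le le_rfl)
  refine le_trans (le_of_eq ?_) (Finset.card_nsmul_le_sum A _ u hAt)
  rw [hA, nsmul_eq_mul, mul_comm]
  push_cast
  rfl

theorem lorentzSeqNormable_of_dilation {Ω : ℕ → ℝ≥0} (hΩ : Ω 0 ≠ 0) {p : ℝ} (hp : 1 ≤ p) {m : ℕ}
    (hm : 1 ≤ m) (hD : ∀ L, ∑ k ∈ Finset.range (m * L), Ω k ≤
      (m / 4 : ℝ≥0) ^ p * ∑ k ∈ Finset.range L, Ω k) :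
    LorentzSeqNormable Ω p := by
  have hp0 : 0 < p := by linarith
  have hip : 0 ≤ 1 / p := by positivity
  let M : (ℕ → ℂ) → ℝ≥0∞ := fun f =>
    (∑' n, (topSum f (n + 1) / (n + 1)) ^ p * (Ω n : ℝ≥0∞)) ^ (1 / p)
  have hrew : ∀ f, M f =
      (∑' n, (topSum f (n + 1) / (n + 1) * (Ω n : ℝ≥0∞) ^ (1 / p)) ^ p) ^ (1 / p) := fun f => by
    simp only [M]
    congr 2
    ext n
    rw [ENNReal.mul_rpow_of_nonneg _ _ hp0.le, ← ENNReal.rpow_mul, one_div_mul_cancel hp0.ne',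
      ENNReal.rpow_one]
  have hcont : ∀ u : ℕ → ℝ≥0∞, (∑' n, u n) ^ (1 / p) =
      ⨆ J, (∑ n ∈ Finset.range J, u n) ^ (1 / p) := fun u => by
    rw [ENNReal.tsum_eq_iSup_nat]
    exact (ENNReal.monotone_rpow_of_nonneg hip).map_iSup_of_continuousAt
      ENNReal.continuous_rpow_const.continuousAt (by simp [hp0])
  refine LorentzSeqNormable.of_equivalent hΩ hp0 M (fun f g => ?_) (fun c f => ?_) (m : ℝ≥0)
    (fun f => ?_) (fun f => ?_)
  · rw [hrew (f + g), hcont]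
    refine iSup_le fun J => ?_
    rw [hrew f, hrew g]
    calc _ ≤ (∑ n ∈ Finset.range J, (topSum f (n + 1) / (n + 1) * (Ω n : ℝ≥0∞) ^ (1 / p) +
            topSum g (n + 1) / (n + 1) * (Ω n : ℝ≥0∞) ^ (1 / p)) ^ p) ^ (1 / p) := by
          gcongr with n _
          rw [← add_mul, ← ENNReal.add_div]
          gcongr
          exact topSum_add_le f g _
      _ ≤ _ := ENNReal.Lp_add_le _ _ _ hp
      _ ≤ _ := by
          gcongr <;> exact ENNReal.sum_le_tsum _
  · simp only [M, topSum_smul, mul_div_assoc, ENNReal.mul_rpow_of_nonneg _ _ hp0.le, mul_assoc,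
      ENNReal.tsum_mul_left]
    rw [ENNReal.mul_rpow_of_nonneg _ _ hip, ← ENNReal.rpow_mul, mul_one_div_cancel hp0.ne',
      ENNReal.rpow_one]
  · refine le_trans ?_ (hardy_inequality hΩ hp hm hD (seqRearrangement_antitone f))
    simp only [M]
    gcongr with n
    exact topSum_div_le_seqAverage f n
  · have h1 : lorentzSeqNorm Ω p f ≤ M f := by
      unfold lorentzSeqNorm
      simp only [M]
      gcongr with n
      exact seqRearrangement_le_topSum_div f n
    refine h1.trans (le_mul_of_one_le_left' ?_)
    exact_mod_cast hm

theorem lorentzSeqNormable_iff_sum_inv_le {Ω : ℕ → ℝ≥0} (hΩ : Ω 0 ≠ 0) {p : ℝ} (hp : 1 < p) :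
    LorentzSeqNormable Ω p ↔
      ∃ C : ℝ≥0, ∀ n : ℕ,
        ∑ k ∈ Finset.range (n + 1), 1 / weightSum Ω k ^ (1 / p) ≤
          C * (((n : ℝ≥0) + 1) / weightSum Ω n ^ (1 / p)) := by
  have hp0 : 0 < p := by linarith
  have hip : 0 ≤ 1 / p := by positivity
  let φ : ℕ → ℝ := fun L => ((∑ k ∈ Finset.range L, Ω k : ℝ≥0) : ℝ) ^ (1 / p)
  have hφ : Monotone φ := fun i j hij => by
    refine Real.rpow_le_rpow (NNReal.coe_nonneg _) ?_ hip
    exact_mod_cast Finset.sum_le_sum_of_subset (Finset.range_mono hij)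
  have hφ1 : 0 < φ 1 := by
    have : (0 : ℝ) < Ω 0 := by exact_mod_cast pos_iff_ne_zero.2 hΩ
    simp only [φ, Finset.sum_range_one]
    positivity
  have hW : ∀ k, ((weightSum Ω k ^ (1 / p) : ℝ≥0) : ℝ) = φ (k + 1) := fun k => rfl
  constructor
  · intro h
    obtain ⟨m, hm, hD⟩ := h.exists_dilation hp
    refine ⟨m, fun n => ?_⟩
    have h1 := sum_inv_le_of_dilation hφ hφ1 hm hD (Nat.succ_pos n)
    rw [← NNReal.coe_le_coe, NNReal.coe_sum]
    simp only [NNReal.coe_mul, NNReal.coe_div, NNReal.coe_one, hW]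
    exact_mod_cast h1
  · rintro ⟨C, hC⟩
    obtain ⟨m, hm, hD⟩ := exists_dilation_of_sum_inv_le hφ hφ1 (C := C) fun N hN => by
      obtain ⟨n, rfl⟩ := Nat.exists_eq_add_of_le' hN
      have h1 := hC n
      rw [← NNReal.coe_le_coe, NNReal.coe_sum] at h1
      simp only [NNReal.coe_mul, NNReal.coe_div, NNReal.coe_one, hW] at h1
      exact_mod_cast h1
    refine lorentzSeqNormable_of_dilation hΩ hp.le hm fun L => ?_
    rcases Nat.eq_zero_or_pos L with rfl | hL
    · simp
    have h1 : (∑ k ∈ Finset.range (m * L), Ω k) ^ (1 / p) ≤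
        (m / 4 : ℝ≥0) * (∑ k ∈ Finset.range L, Ω k) ^ (1 / p) := by
      rw [← NNReal.coe_le_coe]
      have := hD L hL
      simpa [φ] using this
    have h2 := NNReal.rpow_le_rpow h1 hp0.le
    rwa [NNReal.mul_rpow, ← NNReal.rpow_mul, ← NNReal.rpow_mul, one_div_mul_cancel hp0.ne',
      NNReal.rpow_one, NNReal.rpow_one] at h2

/-! ### The characterisation -/

theorem theorem2p5p10 (Ω : ℕ → ℝ≥0) (hΩ : Ω 0 ≠ 0) :
    (∀ p : ℝ, 0 < p → p < 1 →
      (LorentzSeqNormable Ω p ↔ Summable Ω) ∧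
      (Summable Ω → lorentzSeq Ω p = {f : ℕ → ℂ | Memℓp f ∞})) ∧
    (LorentzSeqNormable Ω 1 ↔
      ∃ C : ℝ≥0, ∀ m n : ℕ, 0 < m → m < n →
        weightSum Ω n / ((n : ℝ≥0) + 1) ≤ C * (weightSum Ω m / ((m : ℝ≥0) + 1))) ∧
    (∀ p : ℝ, 1 < p →
      (LorentzSeqNormable Ω p ↔
        ∃ C : ℝ≥0, ∀ n : ℕ,
          ∑ k ∈ Finset.range (n + 1), 1 / weightSum Ω k ^ (1 / p) ≤
            C * (((n : ℝ≥0) + 1) / weightSum Ω n ^ (1 / p)))) := by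
  refine ⟨fun p hp hp1 => ⟨⟨summable_of_lorentzSeqNormable hΩ hp hp1,
      fun h => lorentzSeqNormable_of_summable hΩ h hp⟩,
    fun h => lorentzSeq_eq_of_summable hΩ h hp⟩,
    ⟨exists_weightSum_le_of_lorentzSeqNormable_one,
      fun ⟨_, hC⟩ => lorentzSeqNormable_one_of_weightSum_le hΩ hC⟩,
    fun p hp => lorentzSeqNormable_iff_sum_inv_le hΩ hp⟩
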